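/- Let $k$ be a field. A small DG-category $\mathcal D$ over $k$ has a set of objects and morphism complexes of $k$-vector spaces, with composition satisfying the Leibniz rule; its homotopy category $[\mathcal D]$ has the same objects and morphisms $H^0(\mathrm{Hom}_{\mathcal D}(X,Y))$. Let $\mathsf Y^X=\mathrm{Hom}_{\mathcal D}(-,X)$ be the right DG-module represented by $X$. Recall that $\mathcal D$ is pretriangulated if $[\mathcal D]$ has a zero object and all DG-modules $\mathsf Y^X[n]$ ($n\in\mathbb Z$) and $\mathrm{Cone}(\mathsf Y^f)$ ($f$ a closed morphism of degree $0$ in $\mathcal D$) are homotopy equivalent to representable ones; then $[\mathcal D]$ is a triangulated category. Let $\mathcal D$ be a small pretriangulated DG-category over $k$ and let $[\mathcal D]=\langle\mathcal T_1,\mathcal T_2\rangle$ be a semiorthogonal decomposition, i.e. $\mathcal T_1,\mathcal T_2\subset[\mathcal D]$ are strictly full triangulated subcategories with $\mathrm{Hom}_{[\mathcal D]}(\mathcal T_2,\mathcal T_1)=0$, and every object $F$ of $[\mathcal D]$ fits into a distinguished triangle $F_2\to F\to F_1\to F_2[1]$ with $F_i\in\mathcal T_i$. Then there exist small pretriangulated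 DG-categories $\mathcal D_1,\mathcal D_2$ over $k$, DG-functors $\mathcal D_i\to\mathcal D$ inducing equivalences $[\mathcal D_i]\cong\mathcal T_i$ for $i=1,2$, and a DG-bimodule $\varphi$ (assigning to $M_2\in\mathcal D_2$ and $M_1\in\mathcal D_1$ a complex $\varphi(M_2,M_1)$, covariant in $M_2$ and contravariant in $M_1$) such that $\mathcal D$ is quasiequivalent to the gluing $\mathcal D_1\times_\varphi\mathcal D_2$, i.e. connected to it by a finite chain of quasiequivalences of small DG-categories pointing in arbitrary directions. Here a quasiequivalence is a DG-functor that is a quasiisomorphism on all morphism complexes and essentially surjective up to homotopy equivalence. The gluing $\mathcal D_1\times_\varphi\mathcal D_2$ is the DG-category whose objects are the triples $M=(M_1,M_2,\mu)$ with $M_i\in\mathcal D_i$ and $\mu\in\varphi(M_2,M_1)$ closed of degree $0$. For $M=(M_1,M_2,\mu)$ and $N=(N_1,N_2,\nu)$ its morphisms are $$\mathrm{Hom}^n(M,N)=\mathrm{Hom}^n_{\mathcal D_1}(M_1,N_1)\oplus\mathrm{Hom}^n_{\mathcal D_2}(M_2,N_2)\oplus\varphi^{n-1}(N_2,M_1),$$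 with differential $d(f_1,f_2,f_{21})=(df_1,\,df_2,\,-df_{21}-f_2\circ\mu+\nu\circ f_1)$ and composition $$(f_1,f_2,f_{21})\circ(g_1,g_2,g_{21})=(f_1\circ g_1,\;f_2\circ g_2,\;f_{21}\circ g_1+(-1)^{\deg f_2}f_2\circ g_{21}).$$ -/

import Mathlib

open CategoryTheory

universe w v u

/-! ## Complexes of vector spaces -/

/-- A (cohomological, unbounded) complex of `k`-vector spaces. The differential `X i → X j` is given
for every pair of indices together with a proof of `i + 1 = j`, which avoids casts between equal
degrees. -/
structure Cplx (k : Type w) [Field k] where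
  X : ℤ → Type v
  [addCommGroup : ∀ n, AddCommGroup (X n)]
  [module : ∀ n, Module k (X n)]
  d : ∀ {i j : ℤ}, i + 1 = j → X i →ₗ[k] X j
  d_d : ∀ {i j l : ℤ} (h : i + 1 = j) (h' : j + 1 = l) (x : X i), d h' (d h x) = 0

attribute [instance] Cplx.addCommGroup Cplx.module

namespace Cplx

variable {k : Type w} [Field k]

/-- Closed elements of degree `n`. -/
def cycles (V : Cplx.{w, v} k) (n : ℤ) : Submodule k (V.X n) :=
  LinearMap.ker (V.d (rfl : n + 1 = n + 1))

/-- Exact elements of degree `n`, as a subspace of the closed ones. -/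
def boundaries (V : Cplx.{w, v} k) (n : ℤ) : Submodule k (V.cycles n) :=
  (LinearMap.range (V.d (sub_add_cancel n 1))).comap (V.cycles n).subtype

/-- The cohomology `Hⁿ(V)`. -/
abbrev H (V : Cplx.{w, v} k) (n : ℤ) : Type v := V.cycles n ⧸ V.boundaries n

theorem d_eq_zero_of_mem_cycles {V : Cplx.{w, v} k} {n m : ℤ} (h : n + 1 = m) {x : V.X n}
    (hx : x ∈ V.cycles n) : V.d h x = 0 := by
  subst h; exact hx

theorem exists_of_mem_boundaries {V : Cplx.{w, v} k} {n m : ℤ} (h : m + 1 = n) {x : V.cycles n}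
    (hx : x ∈ V.boundaries n) : ∃ y : V.X m, V.d h y = x := by
  obtain rfl : m = n - 1 := by omega
  exact hx

theorem mem_boundaries {V : Cplx.{w, v} k} {n m : ℤ} (h : m + 1 = n) {x : V.cycles n}
    (y : V.X m) (hy : V.d h y = x) : x ∈ V.boundaries n := by
  obtain rfl : m = n - 1 := by omega
  exact ⟨y, hy⟩

/-- A morphism of complexes. -/
structure Map (V W : Cplx.{w, v} k) where
  app : ∀ n, V.X n →ₗ[k] W.X n
  comm : ∀ {i j : ℤ} (h : i + 1 = j) (x : V.X i), app j (V.d h x) = W.d h (app i x)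

namespace Map

variable {V W : Cplx.{w, v} k} (f : Map V W)

/-- The map induced on closed elements. -/
def cyclesMap (n : ℤ) : V.cycles n →ₗ[k] W.cycles n :=
  (f.app n).restrict fun x hx => by
    change W.d _ (f.app n x) = 0
    rw [← f.comm, d_eq_zero_of_mem_cycles _ hx, map_zero]

/-- The map induced on cohomology. -/
def mapH (n : ℤ) : V.H n →ₗ[k] W.H n :=
  Submodule.mapQ _ _ (f.cyclesMap n) fun x hx => by
    obtain ⟨y, hy⟩ := exists_of_mem_boundaries (sub_add_cancel n 1) hx
    refine mem_boundaries (sub_add_cancel n 1) (f.app _ y) ?_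
    rw [← f.comm, hy]
    rfl

/-- A quasiisomorphism is a morphism of complexes inducing bijections on all cohomology. -/
def IsQuasiIso : Prop := ∀ n, Function.Bijective (f.mapH n)

end Map

/-- The shift `V[n]`, with `V[n]ⁱ = Vⁱ⁺ⁿ` and differential `(-1)ⁿ d`. -/
abbrev shift (V : Cplx.{w, v} k) (n : ℤ) : Cplx.{w, v} k where
  X i := V.X (i + n)
  d h := n.negOnePow • V.d (by omega)
  d_d h h' x := by
    simp only [Units.smul_def, LinearMap.smul_apply, map_zsmul, V.d_d, smul_zero]

end Cplx

/-! ## DG-categories -/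

/-- A DG-category over `k`: `comp f g` is the composition `f ∘ g`, for `f` of degree `a`, `g` of
degree `b`, landing in degree `c = a + b`. -/
structure DGCat (k : Type w) [Field k] where
  Obj : Type u
  Hom : Obj → Obj → Cplx.{w, v} k
  id : ∀ X, (Hom X X).X 0
  comp : ∀ {X Y Z : Obj} {a b c : ℤ}, a + b = c →
    (Hom Y Z).X a →ₗ[k] (Hom X Y).X b →ₗ[k] (Hom X Z).X c
  id_comp : ∀ {X Y : Obj} {a : ℤ} (h : 0 + a = a) (f : (Hom X Y).X a), comp h (id Y) f = f
  comp_id : ∀ {X Y : Obj} {a : ℤ} (h : a + 0 = a) (f : (Hom X Y).X a), comp h f (id X) = f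
  assoc : ∀ {W X Y Z : Obj} {a b c ab bc abc : ℤ} (hab : a + b = ab) (hbc : b + c = bc)
    (h : ab + c = abc) (h' : a + bc = abc)
    (f : (Hom Y Z).X a) (g : (Hom X Y).X b) (e : (Hom W X).X c),
    comp h (comp hab f g) e = comp h' f (comp hbc g e)
  leibniz : ∀ {X Y Z : Obj} {a a' b b' c c' : ℤ} (ha : a + 1 = a') (hb : b + 1 = b')
    (hc : c + 1 = c') (h : a + b = c) (h₁ : a' + b = c') (h₂ : a + b' = c')
    (f : (Hom Y Z).X a) (g : (Hom X Y).X b),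
    (Hom X Z).d hc (comp h f g) =
      comp h₁ ((Hom Y Z).d ha f) g + a.negOnePow • comp h₂ f ((Hom X Y).d hb g)

namespace DGCat

variable {k : Type w} [Field k]

theorem d_id (D : DGCat.{w, v, u} k) (X : D.Obj) {n : ℤ} (h : 0 + 1 = n) :
    (D.Hom X X).d h (D.id X) = 0 := by
  obtain rfl : n = 1 := by omega
  have := D.leibniz h h h (add_zero 0) (by omega) (by omega) (D.id X) (D.id X)
  rw [D.id_comp, D.comp_id, D.id_comp] at this
  simpa using this

/-- Composition of closed morphisms of degree zero. -/
def compZ (D : DGCat.{w, v, u} k) {X Y Z : D.Obj} (g : (D.Hom Y Z).cycles 0)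
    (f : (D.Hom X Y).cycles 0) : (D.Hom X Z).cycles 0 :=
  ⟨D.comp (add_zero 0) g.1 f.1, by
    change (D.Hom X Z).d _ _ = 0
    rw [D.leibniz (a' := 1) (b' := 1) (by omega) (by omega) _ _ (by omega) (by omega),
      Cplx.d_eq_zero_of_mem_cycles _ g.2, Cplx.d_eq_zero_of_mem_cycles _ f.2]
    simp⟩

/-- Composition in the homotopy category: `H⁰` of the composition. -/
def compH (D : DGCat.{w, v, u} k) {X Y Z : D.Obj} :
    (D.Hom Y Z).H 0 → (D.Hom X Y).H 0 → (D.Hom X Z).H 0 :=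
  Quotient.map₂ D.compZ <| by
    intro g g' hg f f' hf
    replace hg := (Submodule.quotientRel_def _).1 hg
    replace hf := (Submodule.quotientRel_def _).1 hf
    refine (Submodule.quotientRel_def _).2 ?_
    have h1 : (-1 : ℤ) + 1 = 0 := by omega
    obtain ⟨y, hy⟩ := Cplx.exists_of_mem_boundaries h1 hg
    obtain ⟨x, hx⟩ := Cplx.exists_of_mem_boundaries h1 hf
    have e1 := D.leibniz h1 (zero_add 1) h1 (add_zero _) (add_zero _) (by omega) y f.1
    have e2 := D.leibniz (zero_add 1) h1 h1 (zero_add _) (by omega) (add_zero 0) g'.1 x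
    rw [Cplx.d_eq_zero_of_mem_cycles _ f.2, hy] at e1
    rw [Cplx.d_eq_zero_of_mem_cycles _ g'.2, hx] at e2
    refine Cplx.mem_boundaries h1
      (D.comp (add_zero (-1)) y f.1 + D.comp (zero_add (-1)) g'.1 x) ?_
    rw [map_add, e1, e2]
    simp [compZ]

/-- The homotopy category `[D]`: same objects as `D`, morphisms `H⁰(Hom_D(X, Y))`. -/
structure HoCat (D : DGCat.{w, v, u} k) where
  obj : D.Obj

instance (D : DGCat.{w, v, u} k) : Category.{v} D.HoCat where
  Hom X Y := (D.Hom X.obj Y.obj).H 0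
  id X := Submodule.Quotient.mk ⟨D.id X.obj, D.d_id X.obj _⟩
  comp f g := D.compH g f
  id_comp := by
    rintro X Y ⟨f⟩
    exact congrArg Submodule.Quotient.mk (Subtype.ext (D.comp_id _ f.1))
  comp_id := by
    rintro X Y ⟨f⟩
    exact congrArg Submodule.Quotient.mk (Subtype.ext (D.id_comp _ f.1))
  assoc := by
    rintro W X Y Z ⟨f⟩ ⟨g⟩ ⟨h⟩
    exact congrArg Submodule.Quotient.mk (Subtype.ext (D.assoc _ _ _ _ h.1 g.1 f.1).symm)

instance (D : DGCat.{w, v, u} k) : Preadditive D.HoCat where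
  homGroup X Y := inferInstanceAs (AddCommGroup ((D.Hom X.obj Y.obj).H 0))
  add_comp := by
    rintro X Y Z ⟨f⟩ ⟨f'⟩ ⟨g⟩
    refine congrArg Submodule.Quotient.mk (Subtype.ext ?_)
    exact map_add (D.comp (add_zero 0) g.1) f.1 f'.1
  comp_add := by
    rintro X Y Z ⟨f⟩ ⟨g⟩ ⟨g'⟩
    refine congrArg Submodule.Quotient.mk (Subtype.ext ?_)
    exact LinearMap.map_add₂ (D.comp (add_zero 0)) g.1 g'.1 f.1

instance (D : DGCat.{w, v, u} k) : Linear k D.HoCat where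
  homModule X Y := inferInstanceAs (Module k ((D.Hom X.obj Y.obj).H 0))
  smul_comp := by
    rintro X Y Z r ⟨f⟩ ⟨g⟩
    refine congrArg Submodule.Quotient.mk (Subtype.ext ?_)
    exact map_smul (D.comp (add_zero 0) g.1) r f.1
  comp_smul := by
    rintro X Y Z ⟨f⟩ r ⟨g⟩
    refine congrArg Submodule.Quotient.mk (Subtype.ext ?_)
    exact LinearMap.map_smul₂ (D.comp (add_zero 0)) r g.1 f.1

/-- Two objects are homotopic (homotopy equivalent) if they are isomorphic in `[D]`. -/
def Homotopic (D : DGCat.{w, v, u} k) (X Y : D.Obj) : Prop :=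
  Nonempty ((⟨X⟩ : D.HoCat) ≅ ⟨Y⟩)

end DGCat

/-! ## DG-functors and quasiequivalences -/

/-- A DG-functor. -/
structure DGFunctor {k : Type w} [Field k] (D E : DGCat.{w, v, u} k) where
  obj : D.Obj → E.Obj
  map : ∀ X Y : D.Obj, Cplx.Map (D.Hom X Y) (E.Hom (obj X) (obj Y))
  map_id : ∀ X, (map X X).app 0 (D.id X) = E.id (obj X)
  map_comp : ∀ {X Y Z : D.Obj} {a b c : ℤ} (h : a + b = c)
    (f : (D.Hom Y Z).X a) (g : (D.Hom X Y).X b),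
    (map X Z).app c (D.comp h f g) = E.comp h ((map Y Z).app a f) ((map X Y).app b g)

namespace DGFunctor

variable {k : Type w} [Field k] {D E : DGCat.{w, v, u} k}

/-- The functor `[F] : [D] ⥤ [E]` induced by a DG-functor `F`. -/
def mapHo (F : DGFunctor D E) : D.HoCat ⥤ E.HoCat where
  obj X := ⟨F.obj X.obj⟩
  map {X Y} f := (F.map X.obj Y.obj).mapH 0 f
  map_id X := congrArg Submodule.Quotient.mk (Subtype.ext (F.map_id X.obj))
  map_comp := by
    rintro X Y Z ⟨f⟩ ⟨g⟩
    exact congrArg Submodule.Quotient.mk (Subtype.ext (F.map_comp (add_zero 0) g.1 f.1))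

/-- A quasiequivalence: quasi fully faithful and essentially surjective up to homotopy. -/
def IsQuasiequivalence (F : DGFunctor D E) : Prop :=
  (∀ X Y, (F.map X Y).IsQuasiIso) ∧ ∀ Y, ∃ X, E.Homotopic (F.obj X) Y

/-- `[F]` takes values in the full subcategory `T` of `[E]` and is an equivalence `[D] ≌ T`. -/
def InducesEquivalence (F : DGFunctor D E) (T : ObjectProperty E.HoCat) : Prop :=
  ∃ h : ∀ X, T (F.mapHo.obj X), (T.lift F.mapHo h).IsEquivalence

end DGFunctor

/-- Two DG-categories are quasiequivalent if they are connected by a finite chain of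
quasiequivalences, pointing in arbitrary directions. -/
def Quasiequivalent {k : Type w} [Field k] (D E : DGCat.{w, v, u} k) : Prop :=
  Relation.EqvGen (fun D E : DGCat.{w, v, u} k => ∃ F : DGFunctor D E, F.IsQuasiequivalence) D E

/-! ## DG-modules -/

/-- A right DG-module over `D`, that is, a DG-functor `M` from `Dᵒᵖ` to complexes. It is written
through the right action `m · g = (-1)^(|m||g|) M(g)(m)`, which satisfies the Leibniz rule
`d(m · g) = dm · g + (-1)^|m| m · dg`. -/
structure DGModule {k : Type w} [Field k] (D : DGCat.{w, v, u} k) where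
  obj : D.Obj → Cplx.{w, v} k
  act : ∀ {X Y : D.Obj} {a b c : ℤ}, a + b = c →
    (obj X).X a →ₗ[k] (D.Hom Y X).X b →ₗ[k] (obj Y).X c
  act_id : ∀ {X : D.Obj} {a : ℤ} (h : a + 0 = a) (m : (obj X).X a), act h m (D.id X) = m
  act_comp : ∀ {X Y Z : D.Obj} {a b c ab bc abc : ℤ} (hab : a + b = ab) (hbc : b + c = bc)
    (h : ab + c = abc) (h' : a + bc = abc)
    (m : (obj X).X a) (f : (D.Hom Y X).X b) (g : (D.Hom Z Y).X c),
    act h (act hab m f) g = act h' m (D.comp hbc f g)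
  leibniz : ∀ {X Y : D.Obj} {a a' b b' c c' : ℤ} (ha : a + 1 = a') (hb : b + 1 = b')
    (hc : c + 1 = c') (h : a + b = c) (h₁ : a' + b = c') (h₂ : a + b' = c')
    (m : (obj X).X a) (f : (D.Hom Y X).X b),
    (obj Y).d hc (act h m f) =
      act h₁ ((obj X).d ha m) f + a.negOnePow • act h₂ m ((D.Hom Y X).d hb f)

namespace DGModule

variable {k : Type w} [Field k] {D : DGCat.{w, v, u} k}

open CochainComplex.HomComplex in
/-- Morphisms `M → N` of degree `n`: families of linear maps `M(X)ⁱ → N(X)ʲ`, for all objects `X`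
and all `i + n = j`, which commute with the right action. -/
def homDeg (M N : DGModule D) (n : ℤ) :
    Submodule k (∀ (X : D.Obj) (t : Triplet n), (M.obj X).X t.p →ₗ[k] (N.obj X).X t.q) where
  carrier := { φ | ∀ {X Y : D.Obj} {i j l i' j' : ℤ} (hi : i + n = i') (hj : j + n = j')
    (h : i + l = j) (h' : i' + l = j') (m : (M.obj X).X i) (g : (D.Hom Y X).X l),
    φ Y ⟨j, j', hj⟩ (M.act h m g) = N.act h' (φ X ⟨i, i', hi⟩ m) g }
  add_mem' hφ hψ := by
    intro X Y i j l i' j' hi hj h h' m g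
    simp [hφ hi hj h h', hψ hi hj h h']
  zero_mem' := by
    intro X Y i j l i' j' hi hj h h' m g
    simp
  smul_mem' r φ hφ := by
    intro X Y i j l i' j' hi hj h h' m g
    simp [hφ hi hj h h']

/-- The component `M(X)ⁱ → N(X)ʲ` of a morphism of degree `n`. -/
def homV {M N : DGModule D} {n : ℤ} (φ : homDeg M N n) (X : D.Obj) {i j : ℤ} (h : i + n = j) :
    (M.obj X).X i →ₗ[k] (N.obj X).X j :=
  φ.1 X ⟨i, j, h⟩

theorem homV_act {M N : DGModule D} {n : ℤ} (φ : homDeg M N n) {X Y : D.Obj}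
    {i j l i' j' : ℤ} (hi : i + n = i') (hj : j + n = j') (h : i + l = j) (h' : i' + l = j')
    (m : (M.obj X).X i) (g : (D.Hom Y X).X l) :
    homV φ Y hj (M.act h m g) = N.act h' (homV φ X hi m) g :=
  φ.2 hi hj h h' m g

theorem hom_ext {M N : DGModule D} {n : ℤ} {φ ψ : homDeg M N n}
    (h : ∀ (X : D.Obj) {i j : ℤ} (h : i + n = j) (m : (M.obj X).X i),
      homV φ X h m = homV ψ X h m) :
    φ = ψ :=
  Subtype.ext (funext fun X => funext fun t => LinearMap.ext fun m => h X t.hpq m)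

/-- The differential `φ ↦ d ∘ φ - (-1)^|φ| φ ∘ d` on morphisms of DG-modules. -/
def homD (M N : DGModule D) {n n' : ℤ} (hn : n + 1 = n') : homDeg M N n →ₗ[k] homDeg M N n' where
  toFun φ := ⟨fun X t =>
    ((N.obj X).d (i := t.p + n) (by have := t.hpq; omega)).comp (homV φ X rfl) -
      n.negOnePow • (homV φ X (by have := t.hpq; omega)).comp ((M.obj X).d rfl), by
    intro X Y i j l i' j' hi hj h h' m g
    have e1 := M.leibniz (c' := j + 1) rfl rfl rfl h (by omega) (by omega) m g
    have e2 := N.leibniz (c := j + n) (c' := j') (a := i + n) (a' := i') (b' := l + 1)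
      (by omega) rfl (by omega) (by omega) (by omega) (by omega) (homV φ X rfl m) g
    simp only [LinearMap.sub_apply, LinearMap.comp_apply, Units.smul_def,
      LinearMap.smul_apply] at e1 e2 ⊢
    rw [e1, homV_act φ rfl rfl h (by omega), e2, map_add, map_zsmul,
      homV_act φ (i' := i') (by omega) _ _ (by omega),
      homV_act φ rfl _ _ (by omega)]
    simp only [map_sub, map_zsmul, LinearMap.sub_apply, LinearMap.smul_apply, smul_add,
      smul_smul, Int.negOnePow_add, Units.val_mul, mul_comm]
    abel⟩
  map_add' φ ψ := by
    refine hom_ext fun X i j h m => ?_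
    simp [homV, smul_add]
    abel
  map_smul' r φ := by
    refine hom_ext fun X i j h m => ?_
    simp [homV, smul_sub, Units.smul_def, smul_comm r]

theorem homV_homD {M N : DGModule D} {n n' : ℤ} (hn : n + 1 = n') (φ : homDeg M N n) (X : D.Obj)
    {i i' j j' : ℤ} (h : i + n' = j') (hi : i + 1 = i') (hj : j + 1 = j') (h₁ : i + n = j)
    (h₂ : i' + n = j') (m : (M.obj X).X i) :
    homV (homD M N hn φ) X h m =
      (N.obj X).d hj (homV φ X h₁ m) - n.negOnePow • homV φ X h₂ ((M.obj X).d hi m) := by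
  subst hi h₁
  rfl

/-- The complex of morphisms of DG-modules. -/
abbrev homCplx (M N : DGModule D) : Cplx.{w, max u v} k where
  X n := homDeg M N n
  d hn := homD M N hn
  d_d := by
    intro i j l h h' φ
    refine hom_ext fun X a b hab m => ?_
    rw [homV_homD h' _ X hab rfl (j := a + j) (by omega) rfl (by omega),
      homV_homD h _ X rfl rfl (j := a + i) (by omega) rfl (by omega),
      homV_homD h _ X _ rfl (j := a + j) (by omega) (by omega) (by omega)]
    subst h
    simp [homV, Int.negOnePow_succ, Units.smul_def, (M.obj X).d_d, (N.obj X).d_d]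

/-- Composition of morphisms of DG-modules. -/
def homComp (L M N : DGModule D) {a b c : ℤ} (h : a + b = c) :
    homDeg M N a →ₗ[k] homDeg L M b →ₗ[k] homDeg L N c :=
  LinearMap.mk₂ k (fun φ ψ => ⟨fun X t =>
      (homV φ X (i := t.p + b) (by have := t.hpq; omega)).comp (homV ψ X rfl), by
    intro X Y i j l i' j' hi hj h h' m g
    simp only [LinearMap.comp_apply]
    rw [homV_act ψ rfl rfl h (by omega), homV_act φ (i' := i') (by omega) _ _ h']⟩)
    (fun _ _ _ => hom_ext fun X i j h m => by simp [homV])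
    (fun _ _ _ => hom_ext fun X i j h m => by simp [homV])
    (fun _ _ _ => hom_ext fun X i j h m => by simp [homV])
    (fun _ _ _ => hom_ext fun X i j h m => by simp [homV])

theorem homV_homComp {L M N : DGModule D} {a b c : ℤ} (h : a + b = c) (φ : homDeg M N a)
    (ψ : homDeg L M b) (X : D.Obj) {i j l : ℤ} (h₁ : i + c = l) (h₂ : i + b = j) (h₃ : j + a = l)
    (m : (L.obj X).X i) :
    homV (homComp L M N h φ ψ) X h₁ m = homV φ X h₃ (homV ψ X h₂ m) := by
  subst h₂
  rfl

/-- The identity morphism of a DG-module, written as `m ↦ m · id` so as to map the component of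
degree `i` to the one of degree `j = i + 0`. -/
def homId (M : DGModule D) : homDeg M M 0 :=
  ⟨fun X t => (M.act t.hpq).flip (D.id X), by
    intro X Y i j l i' j' hi hj h h' m g
    obtain rfl : i = i' := by omega
    obtain rfl : j = j' := by omega
    simp only [LinearMap.flip_apply, M.act_id]⟩

theorem homV_homId (M : DGModule D) (X : D.Obj) {i : ℤ} (h : i + 0 = i) (m : (M.obj X).X i) :
    homV (homId M) X h m = m :=
  M.act_id h m

theorem homId_comp {M N : DGModule D} {a : ℤ} (h : 0 + a = a) (φ : homDeg M N a) :
    homComp M N N h (homId N) φ = φ := by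
  refine hom_ext fun X i j hj m => ?_
  rw [homV_homComp h _ _ X hj hj (by omega), homV_homId]

theorem comp_homId {M N : DGModule D} {a : ℤ} (h : a + 0 = a) (φ : homDeg M N a) :
    homComp M M N h φ (homId M) = φ := by
  refine hom_ext fun X i j hj m => ?_
  rw [homV_homComp h _ _ X hj (add_zero i) hj, homV_homId]

theorem homComp_assoc {W X Y Z : DGModule D} {a b c ab bc abc : ℤ} (hab : a + b = ab)
    (hbc : b + c = bc) (h : ab + c = abc) (h' : a + bc = abc)
    (f : homDeg Y Z a) (g : homDeg X Y b) (e : homDeg W X c) :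
    homComp W X Z h (homComp X Y Z hab f g) e = homComp W Y Z h' f (homComp W X Y hbc g e) := by
  refine hom_ext fun A i j hj m => ?_
  rw [homV_homComp h _ _ A hj rfl (by omega),
    homV_homComp hab _ _ A _ rfl (by omega),
    homV_homComp h' _ _ A hj (j := i + c + b) (by omega) (by omega),
    homV_homComp hbc _ _ A _ rfl (by omega)]

theorem homD_homComp {X Y Z : DGModule D} {a a' b b' c c' : ℤ} (ha : a + 1 = a') (hb : b + 1 = b')
    (hc : c + 1 = c') (h : a + b = c) (h₁ : a' + b = c') (h₂ : a + b' = c')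
    (f : homDeg Y Z a) (g : homDeg X Y b) :
    homD X Z hc (homComp X Y Z h f g) =
      homComp X Y Z h₁ (homD Y Z ha f) g + a.negOnePow • homComp X Y Z h₂ f (homD X Y hb g) := by
  refine hom_ext fun A i j hj m => ?_
  change homV (homD X Z hc (homComp X Y Z h f g)) A hj m =
    homV (homComp X Y Z h₁ (homD Y Z ha f) g) A hj m +
      a.negOnePow • homV (homComp X Y Z h₂ f (homD X Y hb g)) A hj m
  rw [homV_homD hc _ A hj (j := i + c) rfl (by omega) rfl (by omega),
    homV_homComp h _ _ A _ (j := i + b) rfl (by omega),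
    homV_homComp h _ _ A _ (j := i + b') (by omega) (by omega),
    homV_homComp h₁ _ _ A hj (j := i + b) rfl (by omega),
    homV_homComp h₂ _ _ A hj (j := i + b') (by omega) (by omega),
    homV_homD ha _ A _ (j := i + c) (i' := i + b') (by omega) (by omega) (by omega) (by omega),
    homV_homD hb _ A _ (j := i + b) rfl (by omega) rfl (by omega)]
  subst h
  simp only [map_sub, Units.smul_def, map_zsmul, smul_sub, smul_smul, Int.negOnePow_add,
    Units.val_mul]
  abel

end DGModule

/-- The DG-category of right DG-modules over `D`. -/
def DGCat.dgm {k : Type w} [Field k] (D : DGCat.{w, v, u} k) :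
    DGCat.{w, max u v, max w u (v + 1)} k where
  Obj := DGModule D
  Hom M N := DGModule.homCplx M N
  id M := DGModule.homId M
  comp h := DGModule.homComp _ _ _ h
  id_comp := DGModule.homId_comp
  comp_id := DGModule.comp_homId
  assoc := DGModule.homComp_assoc
  leibniz := DGModule.homD_homComp

namespace DGModule

variable {k : Type w} [Field k] {D : DGCat.{w, v, u} k}

/-- The shift `M[n]` of a DG-module, with `M[n](X) = M(X)[n]`. -/
def shift (M : DGModule D) (n : ℤ) : DGModule D where
  obj X := (M.obj X).shift n
  act {X Y} {a b c} h := M.act (a := a + n) (c := c + n) (by omega)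
  act_id h m := M.act_id _ m
  act_comp hab hbc h h' m f g := M.act_comp _ _ _ _ m f g
  leibniz := by
    intro X Y a a' b b' c c' ha hb hc h h₁ h₂ m f
    have := M.leibniz (a := a + n) (a' := a' + n) (c := c + n) (c' := c' + n) (by omega) hb
      (by omega) (by omega) (by omega) (by omega) m f
    refine (congrArg (n.negOnePow • ·) this).trans ?_
    simp only [smul_add, smul_smul, Int.negOnePow_add, Units.smul_def, LinearMap.smul_apply,
      map_zsmul, Units.val_mul]
    congr 2
    rw [mul_comm, mul_assoc, ← Units.val_mul, Int.units_mul_self, Units.val_one, mul_one]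

theorem homV_cycles {M N : DGModule D} (f : (D.dgm.Hom M N).cycles 0) (X : D.Obj)
    {i j i' j' : ℤ} (h : i + 1 = j) (h' : i' + 1 = j') (hi : i + 0 = i') (hj : j + 0 = j')
    (m : (M.obj X).X i) :
    homV f.1 X hj ((M.obj X).d h m) = (N.obj X).d h' (homV f.1 X hi m) := by
  have h0 : homD M N (zero_add 1) f.1 = 0 := Cplx.d_eq_zero_of_mem_cycles (zero_add 1) f.2
  have := homV_homD (zero_add 1) f.1 X (j' := j') (by omega) h h' hi hj m
  rw [h0] at this
  simp only [Int.negOnePow_zero, one_smul] at this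
  exact (sub_eq_zero.1 this.symm).symm

/-- The complex `Cone(f)(X) = Cone(f_X) = N(X) ⊕ M(X)[1]`, with differential
`d(y, x) = (dy + f(x), -dx)`. -/
abbrev coneCplx {M N : DGModule D} (f : (D.dgm.Hom M N).cycles 0) (X : D.Obj) : Cplx.{w, v} k where
  X i := (N.obj X).X i × (M.obj X).X (i + 1)
  d {i j} h :=
    { toFun := fun y => ((N.obj X).d h y.1 + homV f.1 X (by omega) y.2, -(M.obj X).d (by omega) y.2)
      map_add' := fun y z => by
        simp only [Prod.fst_add, Prod.snd_add, map_add, Prod.mk_add_mk, neg_add]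
        congr 1
        abel
      map_smul' := fun r y => by simp }
  d_d := by
    intro i j l h h' y
    have := homV_cycles f X (i := i + 1) (j := j + 1) (by omega) h' (by omega) (by omega) y.2
    refine Prod.ext ?_ ?_
    · change (N.obj X).d h' ((N.obj X).d h y.1 + homV f.1 X _ y.2) +
        homV f.1 X _ (-(M.obj X).d _ y.2) = 0
      rw [map_neg, this, map_add, Cplx.d_d]
      abel
    · change -(M.obj X).d _ (-(M.obj X).d _ y.2) = 0
      rw [map_neg, Cplx.d_d, neg_neg]

/-- The cone of a closed morphism `f : M → N` of degree `0` of DG-modules. -/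
def cone {M N : DGModule D} (f : (D.dgm.Hom M N).cycles 0) : DGModule D where
  obj X := coneCplx f X
  act {X Y} {a b c} h :=
    LinearMap.mk₂ k (fun m g => (N.act h m.1 g, M.act (by omega) m.2 g))
      (fun _ _ _ => by simp) (fun _ _ _ => by simp) (fun _ _ _ => by simp) (fun _ _ _ => by simp)
  act_id h m := Prod.ext (N.act_id _ m.1) (M.act_id _ m.2)
  act_comp hab hbc h h' m f g := Prod.ext (N.act_comp _ _ _ _ _ _ _) (M.act_comp _ _ _ _ _ _ _)
  leibniz := by
    intro X Y a a' b b' c c' ha hb hc h h₁ h₂ m g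
    have e1 := N.leibniz ha hb hc h h₁ h₂ m.1 g
    have e2 := M.leibniz (a := a + 1) (a' := a' + 1) (c := c + 1) (c' := c' + 1) (by omega) hb
      (by omega) (by omega) (by omega) (by omega) m.2 g
    have e3 := homV_act f.1 (i := a + 1) (i' := a') (j := c + 1) (j' := c') (by omega) (by omega)
      (by omega) h₁ m.2 g
    refine Prod.ext ?_ ?_
    · change (N.obj Y).d hc (N.act h m.1 g) + homV f.1 Y _ (M.act _ m.2 g) =
        N.act h₁ ((N.obj X).d ha m.1 + homV f.1 X _ m.2) g +
          a.negOnePow • N.act h₂ m.1 ((D.Hom Y X).d hb g)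
      rw [e1, e3, map_add, LinearMap.add_apply]
      abel
    · change -(M.obj Y).d _ (M.act _ m.2 g) =
        M.act _ (-(M.obj X).d _ m.2) g + a.negOnePow • M.act _ m.2 ((D.Hom Y X).d hb g)
      rw [e2, Int.negOnePow_succ, map_neg, LinearMap.neg_apply, Units.neg_smul]
      abel

end DGModule

namespace DGCat

variable {k : Type w} [Field k]

/-- The representable DG-module `Y^X = Hom_D(-, X)`. -/
def yonedaObj (D : DGCat.{w, v, u} k) (X : D.Obj) : DGModule D where
  obj Y := D.Hom Y X
  act h := D.comp h
  act_id h m := D.comp_id h m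
  act_comp hab hbc h h' m f g := D.assoc hab hbc h h' m f g
  leibniz ha hb hc h h₁ h₂ m f := D.leibniz ha hb hc h h₁ h₂ m f

/-- The Yoneda DG-functor on morphisms: `Y^f : Y^X → Y^Z` is `g ↦ f ∘ g`. -/
def yonedaMap (D : DGCat.{w, v, u} k) {X Z : D.Obj} {n : ℤ} (f : (D.Hom X Z).X n) :
    DGModule.homDeg (D.yonedaObj X) (D.yonedaObj Z) n :=
  ⟨fun A t => D.comp (by have := t.hpq; omega) f, by
    intro X Y i j l i' j' hi hj h h' m g
    exact (D.assoc _ _ _ _ _ _ _).symm⟩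

theorem homD_yonedaMap (D : DGCat.{w, v, u} k) {X Z : D.Obj} {n n' : ℤ} (hn : n + 1 = n')
    (f : (D.Hom X Z).X n) :
    DGModule.homD _ _ hn (D.yonedaMap f) = D.yonedaMap ((D.Hom X Z).d hn f) := by
  refine DGModule.hom_ext fun A i j h m => ?_
  rw [DGModule.homV_homD hn _ A h rfl (j := i + n) (by omega) rfl (by omega)]
  have := D.leibniz hn (b := i) rfl (c := i + n) (c' := j) (by omega) (by omega) (by omega)
    (by omega) f m
  exact sub_eq_of_eq_add this

/-- The closed morphism `Y^f : Y^X → Y^Z` associated with a closed morphism `f : X → Z` of degree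
`0`. -/
def yonedaZ (D : DGCat.{w, v, u} k) {X Z : D.Obj} (f : (D.Hom X Z).cycles 0) :
    (D.dgm.Hom (D.yonedaObj X) (D.yonedaObj Z)).cycles 0 :=
  ⟨D.yonedaMap f.1, by
    refine (D.homD_yonedaMap rfl f.1).trans ?_
    rw [Cplx.d_eq_zero_of_mem_cycles _ f.2]
    refine DGModule.hom_ext fun A i j h m => ?_
    exact LinearMap.map_zero₂ (D.comp _) m⟩

/-- `S` is a shift `X[n]` of `X`: the DG-module `Y^X[n]` is homotopic to `Y^S`. -/
def IsShift (D : DGCat.{w, v, u} k) (n : ℤ) (X S : D.Obj) : Prop :=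
  D.dgm.Homotopic ((D.yonedaObj X).shift n) (D.yonedaObj S)

/-- `C` is a cone of the closed degree `0` morphism `f`: the DG-module `Cone(Y^f)` is homotopic to
`Y^C`. -/
def IsCone (D : DGCat.{w, v, u} k) {X Y : D.Obj} (f : (D.Hom X Y).cycles 0) (C : D.Obj) : Prop :=
  D.dgm.Homotopic (DGModule.cone (D.yonedaZ f)) (D.yonedaObj C)

/-- Pretriangulated DG-categories: `[D]` is a triangulated subcategory of the homotopy category of
DG-modules, i.e. it has a zero object, shifts of representable DG-modules and cones of
morphisms between representable DG-modules are homotopic to representable ones. -/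
structure IsPretriangulated (D : DGCat.{w, v, u} k) : Prop where
  zero : Limits.HasZeroObject D.HoCat
  shift : ∀ (X : D.Obj) (n : ℤ), ∃ S, D.IsShift n X S
  cone : ∀ {X Y : D.Obj} (f : (D.Hom X Y).cycles 0), ∃ C, D.IsCone f C

/-- A strictly full triangulated subcategory of `[D]`: a class of objects that contains a zero
object and is closed under isomorphisms, shifts and cones. -/
structure IsTriangulatedSubcategory (D : DGCat.{w, v, u} k) (P : ObjectProperty D.HoCat) :
    Prop where
  zero : P.ContainsZero
  iso : P.IsClosedUnderIsomorphisms
  shift : ∀ {X S : D.Obj} (n : ℤ), D.IsShift n X S → P ⟨X⟩ → P ⟨S⟩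
  cone : ∀ {X Y C : D.Obj} (f : (D.Hom X Y).cycles 0), D.IsCone f C → P ⟨X⟩ → P ⟨Y⟩ → P ⟨C⟩

/-- A semiorthogonal decomposition `[D] = ⟨T₁, T₂⟩`. -/
structure IsSemiorthogonalDecomposition (D : DGCat.{w, v, u} k) (T₁ T₂ : ObjectProperty D.HoCat) :
    Prop where
  triangulated₁ : D.IsTriangulatedSubcategory T₁
  triangulated₂ : D.IsTriangulatedSubcategory T₂
  hom_eq_zero : ∀ {X Y : D.HoCat}, T₂ X → T₁ Y → ∀ f : X ⟶ Y, f = 0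
  /-- Every object `F` fits into a distinguished triangle `F₂ → F → F₁ → F₂[1]` with `Fᵢ ∈ Tᵢ`. -/
  exists_triangle : ∀ F : D.Obj, ∃ (F₂ F₁ : D.Obj) (f : (D.Hom F₂ F).cycles 0),
    T₂ ⟨F₂⟩ ∧ T₁ ⟨F₁⟩ ∧ D.IsCone f F₁

end DGCat

/-! ## Gluing -/

/-- A DG-bimodule `φ ∈ (D₂ᵒᵖ ⊗ D₁)-dgm`: complexes `φ(M₂, M₁)`, covariant in `M₂ ∈ D₂` and
contravariant in `M₁ ∈ D₁`, with commuting left and right actions satisfying the Leibniz rule. -/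
structure DGBimodule {k : Type w} [Field k] (D₂ D₁ : DGCat.{w, v, u} k) where
  obj : D₂.Obj → D₁.Obj → Cplx.{w, v} k
  lact : ∀ {M N : D₂.Obj} {X : D₁.Obj} {a b c : ℤ}, a + b = c →
    (D₂.Hom M N).X a →ₗ[k] (obj M X).X b →ₗ[k] (obj N X).X c
  ract : ∀ {M : D₂.Obj} {X Y : D₁.Obj} {a b c : ℤ}, a + b = c →
    (obj M X).X a →ₗ[k] (D₁.Hom Y X).X b →ₗ[k] (obj M Y).X c
  id_lact : ∀ {M : D₂.Obj} {X : D₁.Obj} {a : ℤ} (h : 0 + a = a) (m : (obj M X).X a),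
    lact h (D₂.id M) m = m
  ract_id : ∀ {M : D₂.Obj} {X : D₁.Obj} {a : ℤ} (h : a + 0 = a) (m : (obj M X).X a),
    ract h m (D₁.id X) = m
  comp_lact : ∀ {L M N : D₂.Obj} {X : D₁.Obj} {a b c ab bc abc : ℤ} (hab : a + b = ab)
    (hbc : b + c = bc) (h : ab + c = abc) (h' : a + bc = abc)
    (f : (D₂.Hom M N).X a) (g : (D₂.Hom L M).X b) (m : (obj L X).X c),
    lact h (D₂.comp hab f g) m = lact h' f (lact hbc g m)
  ract_comp : ∀ {M : D₂.Obj} {X Y Z : D₁.Obj} {a b c ab bc abc : ℤ} (hab : a + b = ab)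
    (hbc : b + c = bc) (h : ab + c = abc) (h' : a + bc = abc)
    (m : (obj M X).X a) (f : (D₁.Hom Y X).X b) (g : (D₁.Hom Z Y).X c),
    ract h (ract hab m f) g = ract h' m (D₁.comp hbc f g)
  lact_ract : ∀ {M N : D₂.Obj} {X Y : D₁.Obj} {a b c ab bc abc : ℤ} (hab : a + b = ab)
    (hbc : b + c = bc) (h : ab + c = abc) (h' : a + bc = abc)
    (f : (D₂.Hom M N).X a) (m : (obj M X).X b) (g : (D₁.Hom Y X).X c),
    ract h (lact hab f m) g = lact h' f (ract hbc m g)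
  lact_leibniz : ∀ {M N : D₂.Obj} {X : D₁.Obj} {a a' b b' c c' : ℤ} (ha : a + 1 = a')
    (hb : b + 1 = b') (hc : c + 1 = c') (h : a + b = c) (h₁ : a' + b = c') (h₂ : a + b' = c')
    (f : (D₂.Hom M N).X a) (m : (obj M X).X b),
    (obj N X).d hc (lact h f m) =
      lact h₁ ((D₂.Hom M N).d ha f) m + a.negOnePow • lact h₂ f ((obj M X).d hb m)
  ract_leibniz : ∀ {M : D₂.Obj} {X Y : D₁.Obj} {a a' b b' c c' : ℤ} (ha : a + 1 = a')
    (hb : b + 1 = b') (hc : c + 1 = c') (h : a + b = c) (h₁ : a' + b = c') (h₂ : a + b' = c')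
    (m : (obj M X).X a) (f : (D₁.Hom Y X).X b),
    (obj M Y).d hc (ract h m f) =
      ract h₁ ((obj M X).d ha m) f + a.negOnePow • ract h₂ m ((D₁.Hom Y X).d hb f)

namespace DGBimodule

variable {k : Type w} [Field k] {D₁ D₂ : DGCat.{w, v, u} k}

/-- Objects of the gluing: triples `(M₁, M₂, μ)` with `μ ∈ φ(M₂, M₁)` closed of degree `0`. -/
structure GluingObj (φ : DGBimodule D₂ D₁) where
  fst : D₁.Obj
  snd : D₂.Obj
  μ : (φ.obj snd fst).cycles 0

/-- The morphism complexes of the gluing: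
`Homⁿ(M, N) = Homⁿ(M₁, N₁) ⊕ Homⁿ(M₂, N₂) ⊕ φⁿ⁻¹(N₂, M₁)` with differential
`d(f₁, f₂, f₂₁) = (df₁, df₂, -df₂₁ - f₂ ∘ μ + ν ∘ f₁)`. -/
abbrev gluingHom (φ : DGBimodule D₂ D₁) (M N : φ.GluingObj) : Cplx.{w, v} k where
  X n := (D₁.Hom M.fst N.fst).X n × (D₂.Hom M.snd N.snd).X n × (φ.obj N.snd M.fst).X (n - 1)
  d {i j} h :=
    { toFun := fun f =>
        ((D₁.Hom M.fst N.fst).d h f.1, (D₂.Hom M.snd N.snd).d h f.2.1,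
          -(φ.obj N.snd M.fst).d (by omega) f.2.2 - φ.lact (by omega) f.2.1 M.μ.1 +
            φ.ract (by omega) N.μ.1 f.1)
      map_add' := fun f g => by
        simp only [Prod.fst_add, Prod.snd_add, map_add, LinearMap.add_apply, Prod.mk_add_mk]
        congr 2
        abel
      map_smul' := fun r f => by
        simp [smul_sub, smul_add] }
  d_d := by
    intro i j l h h' f
    refine Prod.ext ?_ (Prod.ext ?_ ?_)
    · exact (D₁.Hom M.fst N.fst).d_d h h' f.1
    · exact (D₂.Hom M.snd N.snd).d_d h h' f.2.1
    · have e1 := φ.lact_leibniz h (b' := 1) (c := j - 1) (by omega) (c' := l - 1) (by omega)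
        (by omega) (by omega) (by omega) f.2.1 M.μ.1
      have e2 := φ.ract_leibniz (a' := 1) (by omega) h (c := j - 1) (c' := l - 1) (by omega)
        (by omega) (by omega) (by omega) N.μ.1 f.1
      rw [Cplx.d_eq_zero_of_mem_cycles _ M.μ.2] at e1
      rw [Cplx.d_eq_zero_of_mem_cycles _ N.μ.2] at e2
      simp only [map_zero, LinearMap.zero_apply, smul_zero, add_zero, zero_add,
        Int.negOnePow_zero, one_smul] at e1 e2
      change -(φ.obj N.snd M.fst).d _ (-(φ.obj N.snd M.fst).d _ f.2.2 -
        φ.lact _ f.2.1 M.μ.1 + φ.ract _ N.μ.1 f.1) - φ.lact _ ((D₂.Hom _ _).d _ f.2.1) M.μ.1 +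
          φ.ract _ N.μ.1 ((D₁.Hom _ _).d _ f.1) = 0
      simp only [map_add, map_sub, map_neg, Cplx.d_d]
      rw [e1, e2]
      abel

/-- The composition of the gluing:
`(f₁, f₂, f₂₁) ∘ (g₁, g₂, g₂₁) = (f₁ ∘ g₁, f₂ ∘ g₂, f₂₁ ∘ g₁ + (-1)^|f₂| f₂ ∘ g₂₁)`. -/
def gluingComp (φ : DGBimodule D₂ D₁) {L M N : φ.GluingObj} {a b c : ℤ} (h : a + b = c) :
    (φ.gluingHom M N).X a →ₗ[k] (φ.gluingHom L M).X b →ₗ[k] (φ.gluingHom L N).X c :=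
  LinearMap.mk₂ k (fun f g =>
      (D₁.comp h f.1 g.1, D₂.comp h f.2.1 g.2.1,
        φ.ract (by omega) f.2.2 g.1 + a.negOnePow • φ.lact (by omega) f.2.1 g.2.2))
    (fun f f' g => by
      refine Prod.ext ?_ (Prod.ext ?_ ?_)
      · simp
      · simp
      · simp only [Prod.fst_add, Prod.snd_add, map_add, LinearMap.add_apply, smul_add]
        abel)
    (fun r f g => by
      refine Prod.ext ?_ (Prod.ext ?_ ?_)
      · simp
      · simp
      · simp [smul_add, Units.smul_def, smul_comm r])
    (fun f g g' => by
      refine Prod.ext ?_ (Prod.ext ?_ ?_)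
      · simp
      · simp
      · simp only [Prod.fst_add, Prod.snd_add, map_add, smul_add]
        abel)
    (fun r f g => by
      refine Prod.ext ?_ (Prod.ext ?_ ?_)
      · simp
      · simp
      · simp [smul_add, Units.smul_def, smul_comm r])

/-- The gluing `D₁ ×_φ D₂`. -/
def gluing (φ : DGBimodule D₂ D₁) : DGCat.{w, v, max u v} k where
  Obj := φ.GluingObj
  Hom := φ.gluingHom
  id M := (D₁.id M.fst, D₂.id M.snd, 0)
  comp h := φ.gluingComp h
  id_comp {M N} a h f := by
    refine Prod.ext (D₁.id_comp h f.1) (Prod.ext (D₂.id_comp h f.2.1) ?_)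
    change φ.ract _ 0 f.1 + (0 : ℤ).negOnePow • φ.lact _ (D₂.id N.snd) f.2.2 = f.2.2
    rw [φ.id_lact, map_zero, LinearMap.zero_apply, zero_add, Int.negOnePow_zero, one_smul]
  comp_id {M N} a h f := by
    refine Prod.ext (D₁.comp_id h f.1) (Prod.ext (D₂.comp_id h f.2.1) ?_)
    change φ.ract _ f.2.2 (D₁.id M.fst) + a.negOnePow • φ.lact _ f.2.1 0 = f.2.2
    rw [φ.ract_id, map_zero, smul_zero, add_zero]
  assoc {K L M N} a b c ab bc abc hab hbc h h' f g e := by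
    refine Prod.ext (D₁.assoc hab hbc h h' f.1 g.1 e.1)
      (Prod.ext (D₂.assoc hab hbc h h' f.2.1 g.2.1 e.2.1) ?_)
    change φ.ract _ (φ.ract _ f.2.2 g.1 + a.negOnePow • φ.lact _ f.2.1 g.2.2) e.1 +
        ab.negOnePow • φ.lact _ (D₂.comp hab f.2.1 g.2.1) e.2.2 =
      φ.ract _ f.2.2 (D₁.comp hbc g.1 e.1) +
        a.negOnePow • φ.lact _ f.2.1 (φ.ract _ g.2.2 e.1 + b.negOnePow • φ.lact _ g.2.1 e.2.2)
    subst hab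
    rw [map_add, LinearMap.add_apply,
      φ.ract_comp (bc := bc) _ hbc _ (abc := abc - 1) (by omega),
      φ.comp_lact (bc := bc - 1) _ (by omega) _ (abc := abc - 1) (by omega), map_add]
    simp only [Units.smul_def, map_zsmul, LinearMap.smul_apply]
    rw [φ.lact_ract (bc := bc - 1) _ (by omega) _ (abc := abc - 1) (by omega)]
    simp only [smul_add, smul_smul, Int.negOnePow_add, Units.val_mul]
    abel
  leibniz {L M N} a a' b b' c c' ha hb hc h h₁ h₂ f g := by
    refine Prod.ext (D₁.leibniz ha hb hc h h₁ h₂ f.1 g.1)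
      (Prod.ext (D₂.leibniz ha hb hc h h₁ h₂ f.2.1 g.2.1) ?_)
    have e1 := φ.ract_leibniz (a := a - 1) (a' := a' - 1) (by omega) hb (c := c - 1)
      (c' := c' - 1) (by omega) (by omega) (by omega) (by omega) f.2.2 g.1
    have e2 := φ.lact_leibniz ha (b := b - 1) (b' := b' - 1) (by omega) (c := c - 1)
      (c' := c' - 1) (by omega) (by omega) (by omega) (by omega) f.2.1 g.2.2
    change -(φ.obj N.snd L.fst).d _ (φ.ract _ f.2.2 g.1 + a.negOnePow • φ.lact _ f.2.1 g.2.2) -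
          φ.lact _ (D₂.comp h f.2.1 g.2.1) L.μ.1 + φ.ract _ N.μ.1 (D₁.comp h f.1 g.1) =
      (φ.ract _ (-(φ.obj N.snd M.fst).d _ f.2.2 - φ.lact _ f.2.1 M.μ.1 + φ.ract _ N.μ.1 f.1) g.1 +
        a'.negOnePow • φ.lact _ ((D₂.Hom _ _).d ha f.2.1) g.2.2) +
      a.negOnePow • (φ.ract _ f.2.2 ((D₁.Hom _ _).d hb g.1) +
        a.negOnePow • φ.lact _ f.2.1 (-(φ.obj M.snd L.fst).d _ g.2.2 - φ.lact _ g.2.1 L.μ.1 +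
          φ.ract _ M.μ.1 g.1))
    have hs : ∀ x : (φ.obj N.snd L.fst).X (c' - 1), a.negOnePow • a.negOnePow • x = x := by
      intro x
      rw [smul_smul, Int.units_mul_self, one_smul]
    have e3 := φ.lact_ract (a := a) (b := 0) (c := b) (ab := a' - 1) (bc := b' - 1)
      (abc := c' - 1) (by omega) (by omega) (by omega) (by omega) f.2.1 M.μ.1 g.1
    have e4 := φ.comp_lact (c := 0) (bc := b' - 1) (abc := c' - 1) h (by omega) (by omega)
      (by omega) f.2.1 g.2.1 L.μ.1
    have e5 := φ.ract_comp (a := 0) (ab := a' - 1) (abc := c' - 1) (by omega) h (by omega)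
      (by omega) N.μ.1 f.1 g.1
    have e6 : a'.negOnePow = -a.negOnePow := by rw [← ha, Int.negOnePow_succ]
    have e7 : (a - 1).negOnePow = -a.negOnePow := by
      rw [← sub_add_cancel a 1, Int.negOnePow_succ, neg_neg, sub_add_cancel]
    have e8 : (φ.obj N.snd L.fst).d (i := c - 1) (j := c' - 1) (by omega)
        (a.negOnePow • φ.lact (by omega) f.2.1 g.2.2) =
        a.negOnePow • (φ.obj N.snd L.fst).d (i := c - 1) (j := c' - 1) (by omega)
          (φ.lact (by omega) f.2.1 g.2.2) := by
      simp only [Units.smul_def, map_zsmul]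
    rw [map_add, e8, e1, e2, e4, ← e5]
    simp only [map_add, map_sub, map_neg, LinearMap.add_apply, LinearMap.sub_apply,
      LinearMap.neg_apply, smul_add, smul_sub, smul_neg, Units.neg_smul, hs, e3, e6, e7]
    abel

end DGBimodule

/-!
Let `D₁` and `D₂` be the full DG-subcategories of `D` on the objects of `T₁` and `T₂`. They are
pretriangulated because restricting DG-modules from `D` to `Dᵢ` is a DG-functor, so it preserves
homotopy equivalences, and it commutes with shifts, cones and representable modules
(`IsTriangulatedSubcategory.isPretriangulated`). The gluing bimodule is
`φ(M₂, M₁) = Hom_D(M₁, M₂)[1]`, so that an object of the gluing is a closed morphism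
`μ : M₁ → M₂` of degree `1`.

Such a `μ` should be sent to the cone of `M₁[-1] → M₂`, but `D` has cones only up to homotopy. The
cone does exist strictly as a DG-module, `twist μ = Y^{M₂} ⊕ Y^{M₁}` with `μ` added to the
differential. Let `E` be the DG-category of DG-modules of the form `Y^X` or `twist μ`. Both `D` and
the gluing map to `E`, and both DG-functors are quasiequivalences.

* `D → E` is the Yoneda embedding, which is bijective on morphism complexes. It is essentially
  surjective up to homotopy since `twist μ` is homotopic to the module represented by a cone of
  `M₁[-1] → M₂` (`IsPretriangulated.exists_homotopic_twist`).
* The gluing maps into `E` by triangular matrices (`triMap`). A morphism `twist μ → twist ν` is a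
  `2 × 2` matrix of morphisms of `D` (`twistDesc_bijective`), and the missing corner is
  `Hom(M₂, N₁)`, which is acyclic by semiorthogonality
  (`IsSemiorthogonalDecomposition.exists_d_eq`). Essential surjectivity up to homotopy comes from
  the triangles `F₂ → F → F₁`, whose connecting morphism `μ : F₁ → F₂` of degree `1` satisfies
  `twist μ ≃ Y^F` (`IsCone.exists_twist_homotopic`).

The homotopy equivalences are not written down with explicit inverses: the modules `Y^X` and
`twist μ` are K-projective, so a morphism between them is a homotopy equivalence as soon as it is
pointwise a quasiisomorphism (`IsPointwiseEquiv.homotopic`).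
-/

universe x

/-! ### Complexes with acyclic mapping cone -/

namespace Cplx

variable {k : Type w} [Field k]

/-- Transport of an element along an equality of degrees, needed where two expressions for the same
degree, such as `n - 1 + 1` and `n`, are not definitionally equal. -/
def castX (V : Cplx.{w, v} k) {i j : ℤ} (h : i = j) : V.X i →ₗ[k] V.X j :=
  h ▸ LinearMap.id

@[simp]
theorem castX_rfl (V : Cplx.{w, v} k) {i : ℤ} (x : V.X i) : V.castX rfl x = x := rfl

theorem castX_injective (V : Cplx.{w, v} k) {i j : ℤ} (h : i = j) :
    Function.Injective (V.castX h) := by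
  subst h; exact fun _ _ h => h

theorem castX_surjective (V : Cplx.{w, v} k) {i j : ℤ} (h : i = j) :
    Function.Surjective (V.castX h) := by
  subst h; exact fun x => ⟨x, rfl⟩

theorem d_castX (V : Cplx.{w, v} k) {i i' j : ℤ} (h : i = i') (hj : i' + 1 = j) (x : V.X i) :
    V.d hj (V.castX h x) = V.d (by omega) x := by
  subst h; rfl

theorem castX_d (V : Cplx.{w, v} k) {i j j' : ℤ} (h : i + 1 = j) (hj : j = j') (x : V.X i) :
    V.castX hj (V.d h x) = V.d (by omega) x := by
  subst hj; rfl

namespace Map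

variable {U V W : Cplx.{w, v} k}

/-- The identity morphism. -/
def id (V : Cplx.{w, v} k) : Map V V where
  app _ := LinearMap.id
  comm _ _ := rfl

/-- The mapping cone of `f` is acyclic, stated in terms of elements: whenever `x` is closed and
`f x = d y`, the pair `(x, y)` is a boundary. -/
def IsConeAcyclic (f : Map V W) : Prop :=
  ∀ {i j l : ℤ} (hi : i + 1 = j) (hj : j + 1 = l) (x : V.X l) (y : W.X j),
    x ∈ V.cycles l → f.app l x = W.d hj y →
      ∃ (x' : V.X j) (y' : W.X i), V.d hj x' = x ∧ f.app j x' - y = W.d hi y'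

theorem IsConeAcyclic.isQuasiIso {f : Map V W} (hf : f.IsConeAcyclic) : f.IsQuasiIso := by
  refine fun n => ⟨(injective_iff_map_eq_zero _).2 ?_, ?_⟩
  · rintro ⟨x⟩ hx
    obtain ⟨y, hy⟩ := exists_of_mem_boundaries (sub_add_cancel n 1)
      ((Submodule.Quotient.mk_eq_zero _).1 hx)
    obtain ⟨x', -, h, -⟩ := hf (sub_add_cancel (n - 1) 1) (sub_add_cancel n 1) x.1 y x.2 hy.symm
    exact (Submodule.Quotient.mk_eq_zero _).2 (mem_boundaries _ x' h)
  · rintro ⟨y⟩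
    obtain ⟨x', y', h, h'⟩ := hf (sub_add_cancel n 1) rfl 0 y.1 (zero_mem _) <| by
      rw [map_zero, d_eq_zero_of_mem_cycles _ y.2]
    exact ⟨Submodule.Quotient.mk ⟨x', h⟩,
      (Submodule.Quotient.eq _).2 (mem_boundaries (sub_add_cancel n 1) y' h'.symm)⟩

theorem isConeAcyclic_of_bijective {f : Map V W} (hf : ∀ n, Function.Bijective (f.app n)) :
    f.IsConeAcyclic := by
  intro i j l hi hj x y hx h
  obtain ⟨x', rfl⟩ := (hf j).2 y
  rw [← f.comm] at h
  exact ⟨x', 0, ((hf l).1 h).symm, by simp⟩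

/-- Injectivity and surjectivity on cohomology make the cone acyclic. -/
theorem isConeAcyclic_of_cohomology {f : Map V W}
    (hinj : ∀ {j l : ℤ} (hj : j + 1 = l) (x : V.X l) (y : W.X j), x ∈ V.cycles l →
      f.app l x = W.d hj y → ∃ x', V.d hj x' = x)
    (hsurj : ∀ {i j : ℤ} (hi : i + 1 = j) (y : W.X j), y ∈ W.cycles j →
      ∃ (x : V.X j) (y' : W.X i), x ∈ V.cycles j ∧ f.app j x - y = W.d hi y') :
    f.IsConeAcyclic := by
  intro i j l hi hj x y hx h
  obtain ⟨x₁, rfl⟩ := hinj hj x y hx h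
  obtain ⟨x₂, y', h₂, h'⟩ := hsurj hi (y - f.app j x₁) <| by
    subst hj
    change W.d _ _ = 0
    rw [map_sub, ← h, f.comm, sub_self]
  refine ⟨x₁ + x₂, y', by rw [map_add, d_eq_zero_of_mem_cycles _ h₂, add_zero], ?_⟩
  rw [← h', map_add]
  abel

/-- A degreewise injective map with acyclic cokernel `A` has an acyclic cone. -/
theorem isConeAcyclic_of_acyclic_cokernel {A : Cplx.{w, v} k} {f : Map V W} (p : Map W A)
    (hf : ∀ n, Function.Injective (f.app n)) (hp : ∀ n, Function.Surjective (p.app n))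
    (hpf : ∀ n x, p.app n (f.app n x) = 0)
    (hfp : ∀ n y, p.app n y = 0 → ∃ x, f.app n x = y)
    (hA : ∀ {i j : ℤ} (h : i + 1 = j) (a : A.X j), a ∈ A.cycles j → ∃ b, A.d h b = a) :
    f.IsConeAcyclic := by
  intro i j l hi hj x y hx h
  obtain ⟨b, hb⟩ := hA hi (p.app j y) <| by
    subst hj
    change A.d _ _ = 0
    rw [← p.comm, ← h, hpf]
  obtain ⟨y', rfl⟩ := hp i b
  obtain ⟨x', hx'⟩ := hfp j (y - W.d hi y') <| by rw [map_sub, p.comm, hb, sub_self]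
  refine ⟨x', -y', hf l ?_, ?_⟩
  · rw [f.comm, hx', map_sub, W.d_d, sub_zero, h]
  · rw [hx', map_neg]
    abel

end Map

end Cplx

/-! ### Homotopy equivalences in a DG-category -/

namespace DGCat

variable {k : Type w} [Field k]

theorem castX_comp (D : DGCat.{w, v, u} k) {X Y Z : D.Obj} {a b c a' : ℤ} (ha : a = a')
    (h : a' + b = c) (f : (D.Hom Y Z).X a) (g : (D.Hom X Y).X b) :
    D.comp h ((D.Hom Y Z).castX ha f) g = D.comp (by omega) f g := by
  subst ha; rfl

theorem Homotopic.symm {D : DGCat.{w, v, u} k} {X Y : D.Obj} (h : D.Homotopic X Y) :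
    D.Homotopic Y X :=
  h.map Iso.symm

theorem Homotopic.refl (D : DGCat.{w, v, u} k) (X : D.Obj) : D.Homotopic X X :=
  ⟨Iso.refl _⟩

theorem Homotopic.exists_inverse {D : DGCat.{w, v, u} k} {X Y : D.Obj} (h : D.Homotopic X Y) :
    ∃ (f : (D.Hom X Y).cycles 0) (g : (D.Hom Y X).cycles 0) (s : (D.Hom X X).X (-1))
      (t : (D.Hom Y Y).X (-1)),
      (D.Hom X X).d (neg_add_cancel 1) s = D.comp (add_zero 0) g.1 f.1 - D.id X ∧
      (D.Hom Y Y).d (neg_add_cancel 1) t = D.comp (add_zero 0) f.1 g.1 - D.id Y := by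
  obtain ⟨e⟩ := h
  obtain ⟨f, hf⟩ := Submodule.Quotient.mk_surjective _ e.hom
  obtain ⟨g, hg⟩ := Submodule.Quotient.mk_surjective _ e.inv
  have h₁ := e.hom_inv_id
  have h₂ := e.inv_hom_id
  rw [← hf, ← hg] at h₁ h₂
  obtain ⟨s, hs⟩ := Cplx.exists_of_mem_boundaries (neg_add_cancel 1)
    ((Submodule.Quotient.eq _).1 h₁)
  obtain ⟨t, ht⟩ := Cplx.exists_of_mem_boundaries (neg_add_cancel 1)
    ((Submodule.Quotient.eq _).1 h₂)
  exact ⟨f, g, s, t, hs, ht⟩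

theorem homotopic_of_inverse {D : DGCat.{w, v, u} k} {X Y : D.Obj}
    (f : (D.Hom X Y).cycles 0) (g : (D.Hom Y X).cycles 0) (s : (D.Hom X X).X (-1))
    (t : (D.Hom Y Y).X (-1))
    (hs : (D.Hom X X).d (neg_add_cancel 1) s = D.comp (add_zero 0) g.1 f.1 - D.id X)
    (ht : (D.Hom Y Y).d (neg_add_cancel 1) t = D.comp (add_zero 0) f.1 g.1 - D.id Y) :
    D.Homotopic X Y :=
  ⟨{ hom := Submodule.Quotient.mk f
     inv := Submodule.Quotient.mk g
     hom_inv_id := (Submodule.Quotient.eq _).2 (Cplx.mem_boundaries _ s hs)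
     inv_hom_id := (Submodule.Quotient.eq _).2 (Cplx.mem_boundaries _ t ht) }⟩

/-- Composition with a closed morphism `v` of degree `0`, as a morphism of complexes
`Hom(P, X) → Hom(P, Y)`. -/
def postcomp (D : DGCat.{w, v, u} k) {X Y : D.Obj} (v : (D.Hom X Y).cycles 0) (P : D.Obj) :
    Cplx.Map (D.Hom P X) (D.Hom P Y) where
  app n := D.comp (zero_add n) v.1
  comm {i j} h x := by
    rw [D.leibniz (zero_add 1) h h (zero_add i) (by omega) (zero_add j),
      Cplx.d_eq_zero_of_mem_cycles _ v.2]
    simp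

/-- If composition with `v : X → Y` has an acyclic cone on morphisms out of `X` and `Y`, then `v`
is a homotopy equivalence. -/
theorem homotopic_of_postcomp (D : DGCat.{w, v, u} k) {X Y : D.Obj} (v : (D.Hom X Y).cycles 0)
    (hX : (D.postcomp v X).IsConeAcyclic) (hY : (D.postcomp v Y).IsConeAcyclic) :
    D.Homotopic X Y := by
  -- Surjectivity on `Hom(Y, -)` gives a right inverse `r`; injectivity on `Hom(X, -)`, applied to
  -- `r ∘ v - id`, shows that it is also a left inverse.
  obtain ⟨r, t, hr, ht⟩ := hY (neg_add_cancel 1) (zero_add 1) 0 (D.id Y) (zero_mem _) <| by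
    rw [map_zero, D.d_id]
  let r' : (D.Hom Y X).cycles 0 := ⟨r, hr⟩
  have hv : D.comp (add_zero 0) v.1 (D.comp (add_zero 0) r v.1 - D.id X) =
      (D.Hom X Y).d (neg_add_cancel 1) (D.comp (add_zero (-1)) t v.1) := by
    rw [D.leibniz (neg_add_cancel 1) (zero_add 1) _ _ (add_zero 0) (by omega),
      Cplx.d_eq_zero_of_mem_cycles _ v.2, ← ht, map_sub, D.comp_id, map_sub,
      LinearMap.sub_apply, D.id_comp, ← D.assoc (add_zero 0) (add_zero 0) (add_zero 0)]
    simp [postcomp]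
  obtain ⟨s, -, hs, -⟩ := hX (i := -2) (by omega) (neg_add_cancel 1)
    (D.comp (add_zero 0) r v.1 - D.id X) (D.comp (add_zero (-1)) t v.1)
    (sub_mem (D.compZ r' v).2 (D.d_id X _)) hv
  exact homotopic_of_inverse v r' s t hs ht.symm

end DGCat

/-! ### Pointwise equivalences of DG-modules -/

namespace DGModule

variable {k : Type w} [Field k] {D : DGCat.{w, v, u} k}

/-- The component at `X` of a closed morphism of degree `0` of DG-modules. -/
def evalMap {M N : DGModule D} (f : (D.dgm.Hom M N).cycles 0) (X : D.Obj) :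
    Cplx.Map (M.obj X) (N.obj X) where
  app n := homV f.1 X (add_zero n)
  comm h x := homV_cycles f X h h _ _ x

/-- A closed morphism of degree `0` is a pointwise equivalence if all its components have acyclic
cones. -/
def IsPointwiseEquiv {M N : DGModule D} (f : (D.dgm.Hom M N).cycles 0) : Prop :=
  ∀ X, (evalMap f X).IsConeAcyclic

/-- A homotopy between `g ∘ f` and the identity, evaluated at a closed element. -/
theorem homV_homV_sub_of_homD_eq {M N : DGModule D} {g : homDeg N M 0} {f : homDeg M N 0}
    {s : homDeg M M (-1)}
    (hs : homD M M (neg_add_cancel 1) s = homComp M N M (add_zero 0) g f - homId M) (X : D.Obj)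
    {i j : ℤ} (hi : i + 1 = j) (x : (M.obj X).X j) (hx : x ∈ (M.obj X).cycles j) :
    homV g X (add_zero j) (homV f X (add_zero j) x) - x =
      (M.obj X).d hi (homV s X (by omega) x) := by
  have := congrArg (fun φ : homDeg M M 0 => homV φ X (add_zero j) x) hs
  change homV (homD M M (neg_add_cancel 1) s) X (add_zero j) x =
    homV (homComp M N M (add_zero 0) g f) X (add_zero j) x -
      homV (homId M) X (add_zero j) x at this
  rw [homV_homD _ s X (add_zero j) (rfl : j + 1 = j + 1) hi (by omega) (by omega),
    Cplx.d_eq_zero_of_mem_cycles _ hx, map_zero, smul_zero, sub_zero,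
    homV_homComp _ _ _ X _ (add_zero j) (add_zero j), homV_homId] at this
  exact this.symm

theorem exists_isPointwiseEquiv_of_homotopic {M N : DGModule D} (h : D.dgm.Homotopic M N) :
    ∃ f : (D.dgm.Hom M N).cycles 0, IsPointwiseEquiv f := by
  obtain ⟨f, g, s, t, hs, ht⟩ := h.exists_inverse
  refine ⟨f, fun X => Cplx.Map.isConeAcyclic_of_cohomology ?_ ?_⟩
  · intro j l hj x y hx h
    refine ⟨(evalMap g X).app j y - homV s X (by omega) x, ?_⟩
    rw [map_sub, ← (evalMap g X).comm, ← h]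
    refine (congrArg (_ - ·) (homV_homV_sub_of_homD_eq hs X hj x hx).symm).trans ?_
    exact sub_sub_cancel _ _
  · intro i j hi y hy
    exact ⟨homV g.1 X (add_zero j) y, homV t X (by omega) y,
      ((evalMap g X).cyclesMap j ⟨y, hy⟩).2, homV_homV_sub_of_homD_eq ht X hi y hy⟩

theorem evalMap_act {M N : DGModule D} (f : (D.dgm.Hom M N).cycles 0) {X Y : D.Obj} {a b c : ℤ}
    (h : a + b = c) (m : (M.obj X).X a) (g : (D.Hom Y X).X b) :
    (evalMap f Y).app c (M.act h m g) = N.act h ((evalMap f X).app a m) g :=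
  homV_act f.1 (add_zero a) (add_zero c) h h m g

/-- `P` is K-projective in the sense that `Hom(P, -)` carries pointwise equivalences to maps with
acyclic cones. The conclusion is `Cplx.Map.IsConeAcyclic` for `D.dgm.postcomp f P`, written out in
terms of morphisms of DG-modules. -/
def IsKProjective (P : DGModule D) : Prop :=
  ∀ {M N : DGModule D} (f : (D.dgm.Hom M N).cycles 0), IsPointwiseEquiv f →
    ∀ {i j l : ℤ} (hi : i + 1 = j) (hj : j + 1 = l) (x : homDeg P M l) (y : homDeg P N j),
      homD P M rfl x = 0 → homComp P M N (zero_add l) f.1 x = homD P N hj y →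
        ∃ (x' : homDeg P M j) (y' : homDeg P N i), homD P M hj x' = x ∧
          homComp P M N (zero_add j) f.1 x' - y = homD P N hi y'

theorem IsPointwiseEquiv.homotopic {M N : DGModule D} {f : (D.dgm.Hom M N).cycles 0}
    (hf : IsPointwiseEquiv f) (hM : IsKProjective M) (hN : IsKProjective N) :
    D.dgm.Homotopic M N :=
  D.dgm.homotopic_of_postcomp f (hM f hf) (hN f hf)

/-! ### Morphisms out of representable modules -/

/-- The Yoneda correspondence: an element `p` of `N(X)` gives the morphism `m ↦ p · m` from the
module represented by `X` to `N`. -/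
def yonedaDesc {X : D.Obj} (N : DGModule D) {n : ℤ} :
    (N.obj X).X n →ₗ[k] homDeg (D.yonedaObj X) N n where
  toFun p := ⟨fun A t => N.act (by have := t.hpq; omega) p, by
    intro A B i j l i' j' hi hj h h' m g
    exact (N.act_comp _ _ _ _ _ _ _).symm⟩
  map_add' p q := hom_ext fun A i j h m => LinearMap.map_add₂ (N.act _) p q m
  map_smul' r p := hom_ext fun A i j h m => LinearMap.map_smul₂ (N.act _) r p m

theorem homV_yoneda {X : D.Obj} {N : DGModule D} {n : ℤ} (φ : homDeg (D.yonedaObj X) N n)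
    (A : D.Obj) {i j : ℤ} (h : i + n = j) (m : ((D.yonedaObj X).obj A).X i) :
    homV φ A h m = N.act (by omega) (homV φ X (zero_add n) (D.id X)) m := by
  refine Eq.trans ?_ (homV_act φ (zero_add n) h (zero_add i) (by omega) _ _)
  exact congrArg (homV φ A h) (D.id_comp _ m).symm

theorem yonedaDesc_bijective {X : D.Obj} (N : DGModule D) (n : ℤ) :
    Function.Bijective (yonedaDesc (X := X) N (n := n)) := by
  refine ⟨fun p q h => ?_, fun φ => ⟨homV φ X (zero_add n) (D.id X), ?_⟩⟩
  · have := congrArg (fun φ => homV φ X (zero_add n) (D.id X)) h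
    exact (N.act_id _ p).symm.trans (this.trans (N.act_id _ q))
  · exact (hom_ext fun A _ _ h m => homV_yoneda φ A h m).symm

theorem homD_yonedaDesc {X : D.Obj} (N : DGModule D) {n n' : ℤ} (h : n + 1 = n')
    (p : (N.obj X).X n) :
    homD _ N h (yonedaDesc N p) = yonedaDesc N ((N.obj X).d h p) := by
  refine hom_ext fun A i j hj m => ?_
  rw [homV_homD h _ A hj rfl (j := i + n) (by omega) rfl (by omega)]
  have := N.leibniz h (b := i) rfl (c := i + n) (c' := j) (by omega) (by omega) (by omega)
    (by omega) p m
  exact sub_eq_of_eq_add this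

theorem homComp_yonedaDesc {X : D.Obj} {M N : DGModule D} (f : (D.dgm.Hom M N).cycles 0)
    {n : ℤ} (p : (M.obj X).X n) :
    homComp _ M N (zero_add n) f.1 (yonedaDesc M p) = yonedaDesc N ((evalMap f X).app n p) := by
  refine hom_ext fun A i j hj m => ?_
  refine (homV_homComp _ f.1 _ A hj hj (add_zero j) m).trans ?_
  exact homV_act f.1 (add_zero n) (add_zero j) _ _ p m

theorem yonedaDesc_id (X : D.Obj) :
    yonedaDesc (X := X) (D.yonedaObj X) (D.id X) = homId (D.yonedaObj X) := by
  refine hom_ext fun A i j h m => ?_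
  obtain rfl : i = j := by omega
  exact (D.id_comp _ m).trans (homV_homId _ A h m).symm

theorem yonedaDesc_comp {X Y Z : D.Obj} {a b c : ℤ} (h : a + b = c) (f : (D.Hom Y Z).X a)
    (g : (D.Hom X Y).X b) :
    yonedaDesc (X := X) (D.yonedaObj Z) (D.comp h f g) =
      homComp _ _ _ h (yonedaDesc (X := Y) (D.yonedaObj Z) f)
        (yonedaDesc (X := X) (D.yonedaObj Y) g) := by
  refine hom_ext fun A i j hj m => ?_
  rw [homV_homComp h _ _ A hj rfl (by omega)]
  exact D.assoc h _ _ _ f g m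

theorem isKProjective_yonedaObj (X : D.Obj) : IsKProjective (D.yonedaObj X) := by
  intro M N f hf i j l hi hj x y hx h
  obtain ⟨p, rfl⟩ := (yonedaDesc_bijective M l).2 x
  obtain ⟨q, rfl⟩ := (yonedaDesc_bijective N j).2 y
  rw [homD_yonedaDesc] at hx
  have hp := (yonedaDesc_bijective M _).1 (hx.trans (map_zero _).symm)
  rw [homComp_yonedaDesc, homD_yonedaDesc] at h
  obtain ⟨p', q', hp, hq⟩ := hf X hi hj p q hp ((yonedaDesc_bijective N l).1 h)
  refine ⟨yonedaDesc M p', yonedaDesc N q', ?_, ?_⟩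
  · rw [homD_yonedaDesc, hp]
  · rw [homComp_yonedaDesc, homD_yonedaDesc, ← hq, map_sub]

/-! ### Twisted sums of two representable modules -/

/-- The complex `Hom(X, B) ⊕ Hom(X, A)` with differential `d(y, x) = (dy + μ ∘ x, dx)`. -/
abbrev twistCplx {A B : D.Obj} (μ : (D.Hom A B).cycles 1) (X : D.Obj) : Cplx.{w, v} k where
  X i := (D.Hom X B).X i × (D.Hom X A).X i
  d {i j} h :=
    { toFun := fun m => ((D.Hom X B).d h m.1 + D.comp (by omega) μ.1 m.2, (D.Hom X A).d h m.2)
      map_add' := fun m m' => by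
        simp only [Prod.fst_add, Prod.snd_add, map_add, Prod.mk_add_mk]
        congr 1
        abel
      map_smul' := fun r m => by simp }
  d_d {i j l} h h' m := by
    have := D.leibniz (a' := 2) (by omega) h h' (by omega) (by omega) (by omega) μ.1 m.2
    rw [Cplx.d_eq_zero_of_mem_cycles _ μ.2] at this
    refine Prod.ext ?_ ((D.Hom X A).d_d h h' m.2)
    change (D.Hom X B).d h' ((D.Hom X B).d h m.1 + D.comp _ μ.1 m.2) +
      D.comp _ μ.1 ((D.Hom X A).d h m.2) = 0
    rw [map_add, (D.Hom X B).d_d, this]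
    simp

/-- The extension of the module represented by `A` by the module represented by `B` determined by
a closed morphism `μ : A → B` of degree `1`; it is isomorphic to the cone of the morphism
`Y^A[-1] → Y^B` given by `μ`. -/
def twist {A B : D.Obj} (μ : (D.Hom A B).cycles 1) : DGModule D where
  obj X := twistCplx μ X
  act h :=
    LinearMap.mk₂ k (fun m g => (D.comp h m.1 g, D.comp h m.2 g))
      (fun _ _ _ => by simp) (fun _ _ _ => by simp) (fun _ _ _ => by simp) (fun _ _ _ => by simp)
  act_id h m := Prod.ext (D.comp_id _ m.1) (D.comp_id _ m.2)
  act_comp hab hbc h h' m f g := Prod.ext (D.assoc _ _ _ _ _ _ _) (D.assoc _ _ _ _ _ _ _)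
  leibniz {X Y} a a' b b' c c' ha hb hc h h₁ h₂ m g := by
    have e := D.assoc (a := 1) (ab := a') (abc := c') (by omega) h (by omega) (by omega) μ.1 m.2 g
    refine Prod.ext ?_ (D.leibniz ha hb hc h h₁ h₂ m.2 g)
    change (D.Hom Y B).d hc (D.comp h m.1 g) + D.comp _ μ.1 (D.comp h m.2 g) =
      D.comp h₁ ((D.Hom X B).d ha m.1 + D.comp _ μ.1 m.2) g +
        a.negOnePow • D.comp h₂ m.1 ((D.Hom Y X).d hb g)
    rw [D.leibniz ha hb hc h h₁ h₂ m.1 g, ← e, map_add, LinearMap.add_apply]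
    abel

/-- Elements `p` of `N(B)` and `q` of `N(A)` give the morphism `(y, x) ↦ p · y + q · x` from
`twist μ` to `N`. -/
def twistDesc {A B : D.Obj} (μ : (D.Hom A B).cycles 1) (N : DGModule D) {n : ℤ} :
    (N.obj B).X n × (N.obj A).X n →ₗ[k] homDeg (twist μ) N n where
  toFun p := ⟨fun X t =>
      LinearMap.coprod (N.act (by have := t.hpq; omega) p.1) (N.act (by have := t.hpq; omega) p.2),
    by
      intro X Y i j l i' j' hi hj h h' m g
      have e₁ := N.act_comp (by omega) h h' (by omega) p.1 m.1 g
      have e₂ := N.act_comp (by omega) h h' (by omega) p.2 m.2 g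
      change N.act _ p.1 (D.comp h m.1 g) + N.act _ p.2 (D.comp h m.2 g) =
        N.act _ (N.act _ p.1 m.1 + N.act _ p.2 m.2) g
      rw [← e₁, ← e₂, map_add, LinearMap.add_apply]⟩
  map_add' p q := hom_ext fun X i j h m => by
    change N.act _ (p.1 + q.1) m.1 + N.act _ (p.2 + q.2) m.2 =
      (N.act _ p.1 m.1 + N.act _ p.2 m.2) + (N.act _ q.1 m.1 + N.act _ q.2 m.2)
    simp only [map_add, LinearMap.add_apply]
    abel
  map_smul' r p := hom_ext fun X i j h m => by
    change N.act _ (r • p.1) m.1 + N.act _ (r • p.2) m.2 =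
      r • (N.act _ p.1 m.1 + N.act _ p.2 m.2)
    simp only [map_smul, LinearMap.smul_apply, smul_add]

theorem homV_twistDesc {A B : D.Obj} (μ : (D.Hom A B).cycles 1) (N : DGModule D) {n : ℤ}
    (p : (N.obj B).X n × (N.obj A).X n) (X : D.Obj) {i j : ℤ} (h : i + n = j)
    (m : ((twist μ).obj X).X i) :
    homV (twistDesc μ N p) X h m = N.act (by omega) p.1 m.1 + N.act (by omega) p.2 m.2 := rfl

/-- The values of a morphism out of `twist μ` at the two generators `(id, 0)` and `(0, id)`. -/
def twistEval {A B : D.Obj} {μ : (D.Hom A B).cycles 1} {N : DGModule D} {n : ℤ}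
    (φ : homDeg (twist μ) N n) : (N.obj B).X n × (N.obj A).X n :=
  (homV φ B (zero_add n) (D.id B, 0), homV φ A (zero_add n) (0, D.id A))

theorem twistEval_twistDesc {A B : D.Obj} (μ : (D.Hom A B).cycles 1) (N : DGModule D) {n : ℤ}
    (p : (N.obj B).X n × (N.obj A).X n) : twistEval (twistDesc μ N p) = p := by
  refine Prod.ext ?_ ?_
  · change N.act _ p.1 (D.id B) + N.act _ p.2 0 = p.1
    rw [N.act_id, map_zero, add_zero]
  · change N.act _ p.1 0 + N.act _ p.2 (D.id A) = p.2
    rw [N.act_id, map_zero, zero_add]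

theorem twistDesc_twistEval {A B : D.Obj} {μ : (D.Hom A B).cycles 1} {N : DGModule D} {n : ℤ}
    (φ : homDeg (twist μ) N n) : twistDesc μ N (twistEval φ) = φ := by
  refine hom_ext fun X i j h m => ?_
  have e₁ := homV_act φ (zero_add n) h (zero_add i) (by omega)
    (show ((twist μ).obj B).X 0 from (D.id B, 0)) m.1
  have e₂ := homV_act φ (zero_add n) h (zero_add i) (by omega)
    (show ((twist μ).obj A).X 0 from (0, D.id A)) m.2
  refine (congrArg₂ (· + ·) e₁ e₂).symm.trans ((map_add (homV φ X h) _ _).symm.trans ?_)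
  refine congrArg (homV φ X h) (Prod.ext ?_ ?_)
  · change D.comp _ (D.id B) m.1 + D.comp _ 0 m.2 = m.1
    rw [D.id_comp, map_zero, LinearMap.zero_apply, add_zero]
  · change D.comp _ 0 m.1 + D.comp _ (D.id A) m.2 = m.2
    rw [D.id_comp, map_zero, LinearMap.zero_apply, zero_add]

theorem twistDesc_bijective {A B : D.Obj} (μ : (D.Hom A B).cycles 1) (N : DGModule D) (n : ℤ) :
    Function.Bijective (twistDesc μ N (n := n)) :=
  ⟨Function.LeftInverse.injective (twistEval_twistDesc μ N),
    Function.RightInverse.surjective twistDesc_twistEval⟩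

theorem homD_twistDesc {A B : D.Obj} (μ : (D.Hom A B).cycles 1) (N : DGModule D) {n n' : ℤ}
    (h : n + 1 = n') (p : (N.obj B).X n) (q : (N.obj A).X n) :
    homD _ N h (twistDesc μ N (p, q)) =
      twistDesc μ N ((N.obj B).d h p, (N.obj A).d h q - n.negOnePow • N.act h p μ.1) := by
  refine hom_ext fun X i j hj m => ?_
  rw [homV_homD h _ X hj rfl (j := i + n) (by omega) rfl (by omega)]
  have e₁ := N.leibniz h (b := i) rfl (c := i + n) (c' := j) (by omega) (by omega) (by omega)
    (by omega) p m.1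
  have e₂ := N.leibniz h (b := i) rfl (c := i + n) (c' := j) (by omega) (by omega) (by omega)
    (by omega) q m.2
  have e₃ := N.act_comp (bc := i + 1) (abc := j) h (by omega) (by omega) (by omega) p μ.1 m.2
  change (N.obj X).d _ (N.act _ p m.1 + N.act _ q m.2) - n.negOnePow •
      (N.act _ p ((D.Hom X B).d _ m.1 + D.comp _ μ.1 m.2) + N.act _ q ((D.Hom X A).d _ m.2)) =
    N.act _ ((N.obj B).d h p) m.1 +
      N.act _ ((N.obj A).d h q - n.negOnePow • N.act h p μ.1) m.2
  rw [map_add, e₁, e₂]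
  simp only [map_add, map_sub, Units.smul_def, map_zsmul, LinearMap.sub_apply,
    LinearMap.smul_apply, smul_add, e₃]
  abel

theorem homComp_twistDesc {A B : D.Obj} (μ : (D.Hom A B).cycles 1) {M N : DGModule D}
    (f : (D.dgm.Hom M N).cycles 0) {n : ℤ} (p : (M.obj B).X n) (q : (M.obj A).X n) :
    homComp _ M N (zero_add n) f.1 (twistDesc μ M (p, q)) =
      twistDesc μ N ((evalMap f B).app n p, (evalMap f A).app n q) := by
  refine hom_ext fun X i j hj m => ?_
  refine (homV_homComp _ f.1 _ X hj hj (add_zero j) m).trans ?_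
  rw [homV_twistDesc, map_add]
  exact congrArg₂ (· + ·) (homV_act f.1 (add_zero n) (add_zero j) _ _ p m.1)
    (homV_act f.1 (add_zero n) (add_zero j) _ _ q m.2)

theorem isKProjective_twist {A B : D.Obj} (μ : (D.Hom A B).cycles 1) :
    IsKProjective (twist μ) := by
  -- The lifting problem is solved first at the generator of `Y^B`, with solution `(p', r')`, and
  -- then at the generator of `Y^A`, where the twist contributes the terms `p' · μ` and `r' · μ`.
  intro M N f hf i j l hi hj x y hx h
  obtain ⟨⟨p, q⟩, rfl⟩ := (twistDesc_bijective μ M l).2 x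
  obtain ⟨⟨r, s⟩, rfl⟩ := (twistDesc_bijective μ N j).2 y
  rw [homD_twistDesc] at hx
  rw [homComp_twistDesc, homD_twistDesc] at h
  obtain ⟨hp, hq⟩ := Prod.ext_iff.1 ((twistDesc_bijective μ M _).1 (hx.trans (map_zero _).symm))
  obtain ⟨hpr, hqs⟩ := Prod.ext_iff.1 ((twistDesc_bijective μ N _).1 h)
  dsimp only at hp hq hpr hqs
  obtain ⟨p', r', hp', hr'⟩ := hf B hi hj p r hp hpr
  have hl : l.negOnePow = -j.negOnePow := by rw [← hj, Int.negOnePow_succ]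
  have hi' : j.negOnePow = -i.negOnePow := by rw [← hi, Int.negOnePow_succ]
  have eM := M.leibniz (b' := 2) (c' := l + 1) hj (by omega) rfl hj (by omega) (by omega) p' μ.1
  have eN := N.leibniz (b' := 2) (c' := l) hi (by omega) hj hi (by omega) (by omega) r' μ.1
  rw [Cplx.d_eq_zero_of_mem_cycles _ μ.2, map_zero, smul_zero, add_zero] at eM eN
  obtain ⟨q', s', hq', hs'⟩ := hf A hi hj (q + j.negOnePow • M.act hj p' μ.1)
    (s + j.negOnePow • N.act hi r' μ.1) (by
      change (M.obj A).d rfl _ = 0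
      rw [hl, Units.neg_smul, sub_neg_eq_add] at hq
      rw [map_add, Units.smul_def, map_zsmul, eM, hp']
      exact hq) (by
      simp only [map_add, hqs, Units.smul_def, map_zsmul]
      rw [evalMap_act, eN, ← hr', map_sub, LinearMap.sub_apply, smul_sub]
      abel)
  refine ⟨twistDesc μ M (p', q'), twistDesc μ N (r', s'), ?_, ?_⟩
  · rw [homD_twistDesc, hp', hq', add_sub_cancel_right]
  · rw [homComp_twistDesc, homD_twistDesc]
    refine (map_sub (twistDesc μ N) _ _).symm.trans (congrArg _ (Prod.ext hr' ?_))
    change (evalMap f A).app j q' - s = (N.obj A).d hi s' - i.negOnePow • N.act hi r' μ.1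
    rw [← hs', hi', Units.neg_smul]
    abel

end DGModule

/-! ### Full DG-subcategories -/

theorem DGFunctor.homotopic_map {k : Type w} [Field k] {D E : DGCat.{w, v, u} k}
    (F : DGFunctor D E) {X Y : D.Obj} (h : D.Homotopic X Y) : E.Homotopic (F.obj X) (F.obj Y) :=
  h.map F.mapHo.mapIso

namespace DGCat

variable {k : Type w} [Field k]

/-- The DG-category with objects indexed by `ι` and the morphism complexes of `D` between the
objects `g i`. For an injective `g` this is a full DG-subcategory of `D`. -/
def induced (D : DGCat.{w, v, u} k) {ι : Type x} (g : ι → D.Obj) : DGCat.{w, v, x} k where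
  Obj := ι
  Hom i j := D.Hom (g i) (g j)
  id i := D.id (g i)
  comp h := D.comp h
  id_comp h f := D.id_comp h f
  comp_id h f := D.comp_id h f
  assoc hab hbc h h' f e l := D.assoc hab hbc h h' f e l
  leibniz ha hb hc h h₁ h₂ f e := D.leibniz ha hb hc h h₁ h₂ f e

theorem induced_homotopic {D : DGCat.{w, v, u} k} {ι : Type x} {g : ι → D.Obj} {i j : ι}
    (h : D.Homotopic (g i) (g j)) : (D.induced g).Homotopic i j := by
  obtain ⟨f, f', s, t, hs, ht⟩ := h.exists_inverse
  exact homotopic_of_inverse (D := D.induced g) f f' s t hs ht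

/-- The fully faithful DG-functor from an induced DG-category. -/
def inducedFunctor (D : DGCat.{w, v, u} k) {ι : Type u} (g : ι → D.Obj) :
    DGFunctor (D.induced g) D where
  obj := g
  map _ _ := Cplx.Map.id _
  map_id _ := rfl
  map_comp _ _ _ := rfl

theorem inducedFunctor_inducesEquivalence (D : DGCat.{w, v, u} k) (T : ObjectProperty D.HoCat) :
    (D.inducedFunctor (fun X : {X : D.Obj // T ⟨X⟩} => X.1)).InducesEquivalence T := by
  set F := (D.inducedFunctor (fun X : {X : D.Obj // T ⟨X⟩} => X.1)).mapHo with hF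
  have hT : ∀ X, T (F.obj X) := fun X => X.obj.2
  have : F.Full := ⟨by rintro X Y ⟨f⟩; exact ⟨Submodule.Quotient.mk f, rfl⟩⟩
  have : F.Faithful := ⟨by rintro X Y ⟨f⟩ ⟨g⟩ h; exact h⟩
  have : (T.lift F hT).EssSurj := ⟨fun Y => ⟨⟨⟨Y.obj.obj, Y.property⟩⟩, ⟨Iso.refl _⟩⟩⟩
  exact ⟨hT, {}⟩

/-- Restriction of DG-modules to an induced DG-category. -/
def restrict {D : DGCat.{w, v, u} k} {ι : Type x} (g : ι → D.Obj) (M : DGModule D) :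
    DGModule (D.induced g) where
  obj i := M.obj (g i)
  act h := M.act h
  act_id h m := M.act_id h m
  act_comp hab hbc h h' m f e := M.act_comp hab hbc h h' m f e
  leibniz ha hb hc h h₁ h₂ m f := M.leibniz ha hb hc h h₁ h₂ m f

/-- Restriction of DG-modules as a DG-functor. -/
def restrictFunctor (D : DGCat.{w, v, u} k) {ι : Type u} (g : ι → D.Obj) :
    DGFunctor D.dgm (D.induced g).dgm where
  obj M := restrict g M
  map _ _ :=
    { app _ :=
        { toFun := fun φ => ⟨fun i t => φ.1 (g i) t, fun hi hj h h' m e => φ.2 hi hj h h' m e⟩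
          map_add' := fun _ _ => rfl
          map_smul' := fun _ _ => rfl }
      comm _ _ := rfl }
  map_id _ := rfl
  map_comp _ _ _ := rfl

theorem induced_isShift {D : DGCat.{w, v, u} k} {ι : Type u} {g : ι → D.Obj} {n : ℤ} {i j : ι}
    (h : D.IsShift n (g i) (g j)) : (D.induced g).IsShift n i j :=
  (D.restrictFunctor g).homotopic_map h

theorem induced_isCone {D : DGCat.{w, v, u} k} {ι : Type u} {g : ι → D.Obj} {i j l : ι}
    {f : (D.Hom (g i) (g j)).cycles 0} (h : D.IsCone f (g l)) :
    (D.induced g).IsCone (X := i) (Y := j) f l :=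
  (D.restrictFunctor g).homotopic_map h

theorem IsTriangulatedSubcategory.isPretriangulated {D : DGCat.{w, v, u} k}
    (hD : D.IsPretriangulated) {T : ObjectProperty D.HoCat} (hT : D.IsTriangulatedSubcategory T) :
    (D.induced (fun X : {X : D.Obj // T ⟨X⟩} => X.1)).IsPretriangulated where
  zero := by
    obtain ⟨Z, hZ, hTZ⟩ := hT.zero.exists_zero
    exact ⟨⟨⟨Z.obj, hTZ⟩⟩, (Limits.IsZero.iff_id_eq_zero _).2
      ((Limits.IsZero.iff_id_eq_zero Z).1 hZ)⟩
  shift X n := by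
    obtain ⟨S, hS⟩ := hD.shift X.1 n
    exact ⟨⟨S, hT.shift n hS X.2⟩, induced_isShift hS⟩
  cone {X Y} f := by
    obtain ⟨C, hC⟩ := hD.cone f
    exact ⟨⟨C, hT.cone f hC X.2 Y.2⟩, induced_isCone hC⟩

/-! ### Shifts and cones in terms of morphisms of `D` -/

open DGModule

/-- A shift `S = A[n]` comes with a closed morphism `t : S → A` of degree `n` such that
composition with `t` is a quasiisomorphism from `Hom(X, S)` to `Hom(X, A)[n]`; the conclusion says
that its cone is acyclic. -/
theorem IsShift.exists_generator {D : DGCat.{w, v, u} k} {n : ℤ} {A S : D.Obj}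
    (h : D.IsShift n A S) :
    ∃ t : (D.Hom S A).cycles n, ∀ (X : D.Obj) {i j l i' j' l' : ℤ} (hi : i + 1 = j)
      (hj : j + 1 = l) (hi' : i' + n = i) (hj' : j' + n = j) (hl' : l' + n = l)
      (x : (D.Hom X S).X l') (y : (D.Hom X A).X j), x ∈ (D.Hom X S).cycles l' →
      D.comp (by omega) t.1 x = n.negOnePow • (D.Hom X A).d hj y →
      ∃ (x' : (D.Hom X S).X j') (y' : (D.Hom X A).X i), (D.Hom X S).d (by omega) x' = x ∧
        D.comp (by omega) t.1 x' - y = n.negOnePow • (D.Hom X A).d hi y' := by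
  obtain ⟨τ, hτ⟩ := exists_isPointwiseEquiv_of_homotopic (Homotopic.symm h)
  -- `Y^S → Y^A[n]` is composition with the image `t` of the identity, which has degree `0 + n`.
  obtain ⟨t, ht⟩ : ∃ t : (D.Hom S A).X (0 + n), t = (evalMap τ S).app 0 (D.id S) := ⟨_, rfl⟩
  have hc : ∀ {X : D.Obj} {m l : ℤ} (h : n + m = l) (h' : m + n = l) (x : (D.Hom X S).X m),
      D.comp h ((D.Hom S A).castX (zero_add n) t) x =
        (D.Hom X A).castX h' ((evalMap τ X).app m x) := by
    rintro X m l h rfl x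
    rw [castX_comp, ht]
    exact (homV_yoneda τ.1 X (add_zero m) x).symm
  have ht' : (D.Hom S A).castX (zero_add n) t ∈ (D.Hom S A).cycles n := by
    have h0 := (evalMap τ S).comm (zero_add 1) (D.id S)
    have h1 : ((D.yonedaObj S).obj S).d (zero_add 1) (D.id S) = 0 := D.d_id S _
    have h2 : n.negOnePow • (D.Hom S A).d (j := 1 + n) (by omega) t = 0 := by
      rw [ht]
      exact h0.symm.trans ((congrArg _ h1).trans (map_zero _))
    have h3 := congrArg ((D.Hom S A).castX (add_comm 1 n)) ((smul_eq_zero_iff_eq _).1 h2)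
    rw [Cplx.castX_d, map_zero] at h3
    exact (Cplx.d_castX _ _ _ t).trans h3
  refine ⟨⟨_, ht'⟩, ?_⟩
  rintro X i j l i' j' l' hi hj rfl rfl rfl x y hx h
  obtain ⟨x', y', h₁, h₂⟩ := hτ X (i := i') (j := j') (l := l') (by omega) (by omega) x y hx
    ((hc _ rfl x).symm.trans h)
  exact ⟨x', y', h₁, (congrArg (· - y) (hc _ rfl x')).trans h₂⟩

/-- A cone `C` of `f : X → Y` comes with `p : C → Y` of degree `0` and a closed `q : C → X` of
degree `1` with `dp + f ∘ q = 0`, such that `x ↦ (p ∘ x, q ∘ x)` is a quasiisomorphism from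
`Hom(Z, C)` to the cone of `Hom(Z, f)`. -/
theorem IsCone.exists_generator {D : DGCat.{w, v, u} k} {X Y C : D.Obj}
    {f : (D.Hom X Y).cycles 0} (h : D.IsCone f C) :
    ∃ (p : (D.Hom C Y).X 0) (q : (D.Hom C X).cycles 1),
      (D.Hom C Y).d (zero_add 1) p + D.comp (zero_add 1) f.1 q.1 = 0 ∧
      ∀ (Z : D.Obj) {i j l m : ℤ} (hi : i + 1 = j) (hj : j + 1 = l) (hl : l + 1 = m)
        (x : (D.Hom Z C).X l) (y : (D.Hom Z Y).X j) (z : (D.Hom Z X).X l),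
        x ∈ (D.Hom Z C).cycles l →
        D.comp (zero_add l) p x = (D.Hom Z Y).d hj y + D.comp (zero_add l) f.1 z →
        D.comp (by omega) q.1 x = -(D.Hom Z X).d hl z →
        ∃ (x' : (D.Hom Z C).X j) (y' : (D.Hom Z Y).X i) (z' : (D.Hom Z X).X j),
          (D.Hom Z C).d hj x' = x ∧
          D.comp (zero_add j) p x' - y = (D.Hom Z Y).d hi y' + D.comp (zero_add j) f.1 z' ∧
          D.comp (by omega) q.1 x' - z = -(D.Hom Z X).d hj z' := by
  obtain ⟨γ, hγ⟩ := exists_isPointwiseEquiv_of_homotopic (Homotopic.symm h)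
  obtain ⟨p, hp⟩ : ∃ p : (D.Hom C Y).X 0, p = ((evalMap γ C).app 0 (D.id C)).1 := ⟨_, rfl⟩
  obtain ⟨q, hq⟩ : ∃ q : (D.Hom C X).X 1, q = ((evalMap γ C).app 0 (D.id C)).2 := ⟨_, rfl⟩
  have hc : ∀ {Z : D.Obj} {n : ℤ} (x : (D.Hom Z C).X n),
      (evalMap γ Z).app n x = (D.comp (zero_add n) p x, D.comp (add_comm _ _) q x) := by
    intro Z n x
    rw [hp, hq]
    exact homV_yoneda γ.1 Z (add_zero n) x
  have h0 : (DGModule.coneCplx (D.yonedaZ f) C).d (zero_add 1) (p, q) = 0 := by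
    have h0 := (evalMap γ C).comm (zero_add 1) (D.id C)
    have h1 : ((D.yonedaObj C).obj C).d (zero_add 1) (D.id C) = 0 := D.d_id C _
    rw [hp, hq]
    exact h0.symm.trans ((congrArg _ h1).trans (map_zero _))
  obtain ⟨hpf, hq'⟩ := Prod.ext_iff.1 h0
  refine ⟨p, ⟨q, neg_eq_zero.1 hq'⟩, hpf, ?_⟩
  rintro Z i j l m rfl rfl rfl x y z hx h h'
  obtain ⟨x', ⟨y', z'⟩, h₁, h₂⟩ := hγ Z rfl rfl x (y, z) hx
    ((hc x).trans (Prod.ext h h'))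
  obtain ⟨h₃, h₄⟩ := Prod.ext_iff.1 h₂
  have hx' := Prod.ext_iff.1 (hc x')
  exact ⟨x', y', z', h₁, (congrArg (· - y) hx'.1).symm.trans h₃,
    (congrArg (· - z) hx'.2).symm.trans h₄⟩

/-- Composition with a closed morphism of odd degree anticommutes with the differential. -/
theorem d_comp_of_odd (D : DGCat.{w, v, u} k) {X Y Z : D.Obj} {n : ℤ} (hn : Odd n)
    (t : (D.Hom Y Z).cycles n) {i j i' j' : ℤ} (hi : i + 1 = j) (hi' : i' + 1 = j')
    (h : n + i = i') (h' : n + j = j') (s : (D.Hom X Y).X i) :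
    (D.Hom X Z).d hi' (D.comp h t.1 s) = -D.comp h' t.1 ((D.Hom X Y).d hi s) := by
  rw [D.leibniz (a' := n + 1) rfl hi hi' h (by omega) h', Cplx.d_eq_zero_of_mem_cycles _ t.2,
    Int.negOnePow_odd n hn, map_zero, LinearMap.zero_apply, zero_add, Units.neg_smul, one_smul]

/-- The twisted sum given by `μ : A → B` is homotopic to a representable module, namely to the one
represented by the cone of the morphism `A[-1] → B` given by `μ`. -/
theorem IsPretriangulated.exists_homotopic_twist {D : DGCat.{w, v, u} k}
    (hD : D.IsPretriangulated) {A B : D.Obj} (μ : (D.Hom A B).cycles 1) :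
    ∃ C, D.dgm.Homotopic (D.yonedaObj C) (twist μ) := by
  obtain ⟨S, hS⟩ := hD.shift A (-1)
  obtain ⟨t, ht⟩ := hS.exists_generator
  have hneg : (-1 : ℤ).negOnePow = -1 := Int.negOnePow_odd _ (by decide)
  simp only [hneg, Units.neg_smul, one_smul] at ht
  obtain ⟨f, hf⟩ : ∃ f : (D.Hom S B).cycles 0, f.1 = D.comp (by omega) μ.1 t.1 := by
    refine ⟨⟨D.comp (by omega) μ.1 t.1, ?_⟩, rfl⟩
    change (D.Hom S B).d _ _ = 0
    rw [D.d_comp_of_odd odd_one μ (j := 0) (by omega) _ _ (by omega),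
      Cplx.d_eq_zero_of_mem_cycles _ t.2, map_zero, neg_zero]
  have hfs : ∀ {Z : D.Obj} {i j : ℤ} (h : -1 + i = j) (s : (D.Hom Z S).X i),
      D.comp (zero_add i) f.1 s = D.comp (by omega) μ.1 (D.comp h t.1 s) := by
    intro Z i j h s
    rw [hf, D.assoc]
  obtain ⟨C, hC⟩ := hD.cone f
  obtain ⟨p, q, hpq, hC⟩ := hC.exists_generator
  -- The morphism `Y^C → Y^B ⊕ Y^A` with components `p` and `t ∘ q`.
  have hv : homD _ (twist μ) rfl (yonedaDesc (X := C) (twist μ)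
      (n := 0) (p, D.comp (by omega) t.1 q.1)) = 0 := by
    refine (homD_yonedaDesc _ _ _).trans ((congrArg _ (Prod.ext ?_ ?_)).trans (map_zero _))
    · change (D.Hom C B).d _ p + D.comp _ μ.1 (D.comp _ t.1 q.1) = 0
      rw [← hpq, hfs (j := 0) (by omega)]
    · change (D.Hom C A).d _ (D.comp _ t.1 q.1) = 0
      rw [D.d_comp_of_odd (by decide) t (j := 2) (by omega) _ _ (by omega),
        Cplx.d_eq_zero_of_mem_cycles _ q.2, map_zero, neg_zero]
  refine ⟨C, IsPointwiseEquiv.homotopic (f := ⟨_, hv⟩) ?_ (isKProjective_yonedaObj C)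
    (isKProjective_twist μ)⟩
  rintro Z i j l hi hj (x : (D.Hom Z C).X l) ⟨(y : (D.Hom Z B).X j), (z : (D.Hom Z A).X j)⟩
    (hx : x ∈ (D.Hom Z C).cycles l) h
  obtain ⟨h₁, h₂⟩ := Prod.ext_iff.1 h
  replace h₁ : D.comp (zero_add l) p x = (D.Hom Z B).d hj y + D.comp (by omega) μ.1 z := h₁
  replace h₂ : D.comp (zero_add l) (D.comp (by omega) t.1 q.1) x = (D.Hom Z A).d hj z := h₂
  rw [D.assoc (bc := l + 1) _ (by omega) _ (by omega)] at h₂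
  have hqx : D.comp (add_comm 1 l) q.1 x ∈ (D.Hom Z S).cycles (l + 1) := by
    change (D.Hom Z S).d _ _ = 0
    rw [D.d_comp_of_odd odd_one q (j := l + 1) rfl _ _ (by omega),
      Cplx.d_eq_zero_of_mem_cycles _ hx, map_zero, neg_zero]
  -- The lifting problem is solved first for `t` and then for the cone of `f`.
  obtain ⟨s, y', hs, hy'⟩ := ht Z hi hj (i' := j) (j' := l) (by omega) (by omega) (by omega)
    _ (-z) hqx (by rw [h₂, map_neg, neg_neg])
  rw [sub_neg_eq_add] at hy'
  obtain ⟨x', y'', z'', hx', hp, hq⟩ := hC Z hi hj rfl x (y + D.comp (by omega) μ.1 y') (-s) hx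
    (by
      rw [h₁, map_add, D.d_comp_of_odd odd_one μ hi _ _ (by omega), map_neg,
        hfs (j := j) (by omega), ← neg_eq_iff_eq_neg.2 hy', map_neg, map_add]
      abel)
    (by rw [map_neg, neg_neg, hs])
  refine ⟨x', (y'', y' + D.comp (by omega) t.1 z''), hx', Prod.ext ?_ ?_⟩
  · change D.comp _ p x' - y = (D.Hom Z B).d hi y'' +
      D.comp _ μ.1 (y' + D.comp _ t.1 z'')
    rw [hfs (j := i) (by omega), sub_add_eq_sub_sub, sub_eq_iff_eq_add] at hp
    rw [hp, map_add]
    abel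
  · change D.comp _ (D.comp _ t.1 q.1) x' - z = (D.Hom Z A).d hi (y' + D.comp _ t.1 z'')
    rw [D.assoc (bc := l) _ (by omega) _ (by omega), sub_eq_iff_eq_add.1 hq, map_add, map_add,
      D.d_comp_of_odd (by decide) t hj _ _ (by omega), ← neg_eq_iff_eq_neg.2 hy', map_neg,
      map_neg]
    abel

/-- If `F₂ → F → F₁` is a distinguished triangle, then `F` is homotopic to the twisted sum of `F₂`
and `F₁` given by the connecting morphism `F₁ → F₂` of degree `1`. -/
theorem IsCone.exists_twist_homotopic {D : DGCat.{w, v, u} k} {F₂ F F₁ : D.Obj}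
    {f : (D.Hom F₂ F).cycles 0} (h : D.IsCone f F₁) :
    ∃ μ : (D.Hom F₁ F₂).cycles 1, D.dgm.Homotopic (twist μ) (D.yonedaObj F) := by
  obtain ⟨p, q, hpq, h⟩ := h.exists_generator
  -- The morphism `twist q → Y^F` with components `f` and `-p`.
  have hv : homD (twist q) (D.yonedaObj F) rfl (twistDesc q (D.yonedaObj F)
      (n := 0) (f.1, -p)) = 0 := by
    refine (homD_twistDesc _ _ _ _ _).trans ((congrArg _ (Prod.ext ?_ ?_)).trans (map_zero _))
    · exact Cplx.d_eq_zero_of_mem_cycles _ f.2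
    · change (D.Hom F₁ F).d _ (-p) - (0 : ℤ).negOnePow • D.comp _ f.1 q.1 = 0
      have e : (D.Hom F₁ F).d (zero_add 1) (-p) - D.comp (zero_add 1) f.1 q.1 = 0 := by
        rw [map_neg, ← neg_add', hpq, neg_zero]
      rw [Int.negOnePow_zero, one_smul]
      exact e
  -- The cone of `twist q → Y^F` at `Z` is, up to signs, the cone of
  -- `Hom(Z, F₁) → Cone(Hom(Z, f))`.
  refine ⟨q, IsPointwiseEquiv.homotopic (f := ⟨_, hv⟩) ?_ (isKProjective_twist q)
    (isKProjective_yonedaObj F)⟩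
  rintro Z i j l hi hj ⟨(x₂ : (D.Hom Z F₂).X l), (x₁ : (D.Hom Z F₁).X l)⟩
    (y : (D.Hom Z F).X j) hx h'
  obtain ⟨hx₂, hx₁⟩ := Prod.ext_iff.1 hx
  replace hx₂ : (D.Hom Z F₂).d rfl x₂ + D.comp (add_comm _ _) q.1 x₁ = 0 := hx₂
  replace h' : D.comp (zero_add l) f.1 x₂ + D.comp (zero_add l) (-p) x₁ = (D.Hom Z F).d hj y := h'
  rw [map_neg, LinearMap.neg_apply] at h'
  obtain ⟨x₁', y', x₂', h₁, h₂, h₃⟩ := h Z hi hj rfl x₁ (-y) x₂ hx₁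
    (by rw [map_neg, ← h']; abel) (eq_neg_of_add_eq_zero_right hx₂)
  refine ⟨(x₂', x₁'), -y', Prod.ext ?_ h₁, ?_⟩
  · change (D.Hom Z F₂).d hj x₂' + D.comp _ q.1 x₁' = x₂
    rw [sub_eq_iff_eq_add.1 h₃]
    abel
  · change D.comp _ f.1 x₂' + D.comp _ (-p) x₁' - y = (D.Hom Z F).d hi (-y')
    rw [map_neg, map_neg, LinearMap.neg_apply]
    rw [sub_neg_eq_add] at h₂
    rw [← sub_eq_iff_eq_add.2 h₂]
    abel

/-- Semiorthogonality: the complexes of morphisms from `T₂` to `T₁` are acyclic. -/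
theorem IsSemiorthogonalDecomposition.exists_d_eq {D : DGCat.{w, v, u} k}
    (hD : D.IsPretriangulated) {T₁ T₂ : ObjectProperty D.HoCat}
    (hT : D.IsSemiorthogonalDecomposition T₁ T₂) {A B : D.Obj} (hA : T₂ ⟨A⟩) (hB : T₁ ⟨B⟩)
    {i j : ℤ} (h : i + 1 = j) (g : (D.Hom A B).X j) (hg : g ∈ (D.Hom A B).cycles j) :
    ∃ g', (D.Hom A B).d h g' = g := by
  obtain ⟨S, hS⟩ := hD.shift B j
  obtain ⟨t, ht⟩ := hS.exists_generator
  obtain ⟨x, y, hx, hy⟩ := ht A (i' := -1) (j' := 0) (l' := 1) h rfl (by omega) (by omega)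
    (by omega) 0 g (zero_mem _) (by
      rw [map_zero, Cplx.d_eq_zero_of_mem_cycles _ hg, smul_zero])
  -- Up to a boundary, `g` is `t ∘ x` for a closed `x : A → S = B[j]` of degree `0`, and `x` is
  -- exact because `S` lies in `T₁`.
  have hx0 : (Submodule.Quotient.mk ⟨x, hx⟩ : (D.Hom A S).H 0) = 0 :=
    hT.hom_eq_zero (X := ⟨A⟩) (Y := ⟨S⟩) hA (hT.triangulated₁.shift j hS hB) _
  obtain ⟨z, hz⟩ := Cplx.exists_of_mem_boundaries (neg_add_cancel 1)
    ((Submodule.Quotient.mk_eq_zero _).1 hx0)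
  refine ⟨j.negOnePow • (D.comp (by omega) t.1 z - y), ?_⟩
  have e := D.leibniz (a := j) rfl (neg_add_cancel 1) h (by omega) (by omega) (by omega) t.1 z
  rw [Cplx.d_eq_zero_of_mem_cycles _ t.2, map_zero, LinearMap.zero_apply, zero_add, hz] at e
  simp only [Units.smul_def, map_zsmul, map_sub]
  simp only [← Units.smul_def, smul_sub]
  rw [e, smul_smul, Int.units_mul_self, one_smul, ← hy]
  exact sub_sub_cancel _ _

end DGCat

/-! ### Triangular morphisms between twisted sums -/

namespace DGModule

variable {k : Type w} [Field k] {D : DGCat.{w, v, u} k}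

/-- The morphism `(y, x) ↦ (f₂ ∘ y + f₂₁ ∘ x, f₁ ∘ x)` from `twist μ` to `twist ν`. -/
def triMap {A B A' B' : D.Obj} (μ : (D.Hom A B).cycles 1) (ν : (D.Hom A' B').cycles 1) {n : ℤ}
    (f₁ : (D.Hom A A').X n) (f₂ : (D.Hom B B').X n) (f₂₁ : (D.Hom A B').X n) :
    homDeg (twist μ) (twist ν) n :=
  twistDesc μ (twist ν) ((f₂, 0), (f₂₁, f₁))

theorem homV_triMap {A B A' B' : D.Obj} (μ : (D.Hom A B).cycles 1) (ν : (D.Hom A' B').cycles 1)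
    {n : ℤ} (f₁ : (D.Hom A A').X n) (f₂ : (D.Hom B B').X n) (f₂₁ : (D.Hom A B').X n) (X : D.Obj)
    {i j : ℤ} (h : i + n = j) (m : ((twist μ).obj X).X i) :
    homV (triMap μ ν f₁ f₂ f₂₁) X h m =
      (D.comp (by omega) f₂ m.1 + D.comp (by omega) f₂₁ m.2, D.comp (by omega) f₁ m.2) := by
  refine Prod.ext rfl ?_
  change D.comp _ 0 m.1 + D.comp _ f₁ m.2 = D.comp _ f₁ m.2
  rw [map_zero, LinearMap.zero_apply, zero_add]

theorem triMap_add {A B A' B' : D.Obj} (μ : (D.Hom A B).cycles 1) (ν : (D.Hom A' B').cycles 1)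
    {n : ℤ} (f₁ g₁ : (D.Hom A A').X n) (f₂ g₂ : (D.Hom B B').X n) (f₂₁ g₂₁ : (D.Hom A B').X n) :
    triMap μ ν (f₁ + g₁) (f₂ + g₂) (f₂₁ + g₂₁) = triMap μ ν f₁ f₂ f₂₁ + triMap μ ν g₁ g₂ g₂₁ := by
  refine hom_ext fun X i j h m => ?_
  change _ = homV (triMap μ ν f₁ f₂ f₂₁) X h m + homV (triMap μ ν g₁ g₂ g₂₁) X h m
  rw [homV_triMap, homV_triMap, homV_triMap]
  refine Prod.ext ?_ (LinearMap.map_add₂ (D.comp _) f₁ g₁ m.2)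
  change D.comp _ (f₂ + g₂) m.1 + D.comp _ (f₂₁ + g₂₁) m.2 =
    (D.comp _ f₂ m.1 + D.comp _ f₂₁ m.2) + (D.comp _ g₂ m.1 + D.comp _ g₂₁ m.2)
  simp only [map_add, LinearMap.add_apply]
  abel

theorem triMap_smul {A B A' B' : D.Obj} (μ : (D.Hom A B).cycles 1) (ν : (D.Hom A' B').cycles 1)
    {n : ℤ} (r : k) (f₁ : (D.Hom A A').X n) (f₂ : (D.Hom B B').X n) (f₂₁ : (D.Hom A B').X n) :
    triMap μ ν (r • f₁) (r • f₂) (r • f₂₁) = r • triMap μ ν f₁ f₂ f₂₁ := by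
  refine hom_ext fun X i j h m => ?_
  change _ = r • homV (triMap μ ν f₁ f₂ f₂₁) X h m
  rw [homV_triMap, homV_triMap]
  refine Prod.ext ?_ (LinearMap.map_smul₂ (D.comp _) r f₁ m.2)
  change D.comp _ (r • f₂) m.1 + D.comp _ (r • f₂₁) m.2 =
    r • (D.comp _ f₂ m.1 + D.comp _ f₂₁ m.2)
  simp only [map_smul, LinearMap.smul_apply, smul_add]

theorem homD_triMap {A B A' B' : D.Obj} (μ : (D.Hom A B).cycles 1) (ν : (D.Hom A' B').cycles 1)
    {n n' : ℤ} (h : n + 1 = n') (f₁ : (D.Hom A A').X n) (f₂ : (D.Hom B B').X n)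
    (f₂₁ : (D.Hom A B').X n) :
    homD _ _ h (triMap μ ν f₁ f₂ f₂₁) =
      triMap μ ν ((D.Hom A A').d h f₁) ((D.Hom B B').d h f₂)
        ((D.Hom A B').d h f₂₁ + D.comp (by omega) ν.1 f₁ -
          n.negOnePow • D.comp h f₂ μ.1) := by
  refine (homD_twistDesc μ (twist ν) h (f₂, 0) (f₂₁, f₁)).trans (congrArg _ ?_)
  refine Prod.ext (Prod.ext ?_ ?_) (Prod.ext rfl ?_)
  · change (D.Hom B B').d h f₂ + D.comp _ ν.1 0 = (D.Hom B B').d h f₂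
    rw [map_zero, add_zero]
  · exact map_zero _
  · change (D.Hom A A').d h f₁ - n.negOnePow • D.comp h 0 μ.1 = (D.Hom A A').d h f₁
    rw [map_zero, LinearMap.zero_apply, smul_zero, sub_zero]

theorem homComp_triMap {A B A' B' A'' B'' : D.Obj} (μ : (D.Hom A B).cycles 1)
    (ν : (D.Hom A' B').cycles 1) (ξ : (D.Hom A'' B'').cycles 1) {a b c : ℤ} (h : a + b = c)
    (f₁ : (D.Hom A' A'').X a) (f₂ : (D.Hom B' B'').X a) (f₂₁ : (D.Hom A' B'').X a)
    (g₁ : (D.Hom A A').X b) (g₂ : (D.Hom B B').X b) (g₂₁ : (D.Hom A B').X b) :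
    homComp _ _ _ h (triMap ν ξ f₁ f₂ f₂₁) (triMap μ ν g₁ g₂ g₂₁) =
      triMap μ ξ (D.comp h f₁ g₁) (D.comp h f₂ g₂)
        (D.comp h f₂₁ g₁ + D.comp h f₂ g₂₁) := by
  refine hom_ext fun X i j hj m => ?_
  rw [homV_homComp h _ _ X hj rfl (by omega), homV_triMap, homV_triMap, homV_triMap]
  refine Prod.ext ?_ ?_
  · dsimp only
    rw [map_add, map_add, LinearMap.add_apply,
      D.assoc (bc := i + b) h (by omega) (by omega) (by omega),
      D.assoc (bc := i + b) h (by omega) (by omega) (by omega),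
      D.assoc (bc := i + b) h (by omega) (by omega) (by omega)]
    abel
  · exact (D.assoc h (by omega) (by omega) (by omega) _ _ _).symm

theorem triMap_id {A B : D.Obj} (μ : (D.Hom A B).cycles 1) :
    triMap μ μ (D.id A) (D.id B) 0 = homId (twist μ) := by
  refine hom_ext fun X i j hj m => ?_
  obtain rfl : i = j := by omega
  rw [homV_homId, homV_triMap]
  refine Prod.ext ?_ (D.id_comp _ _)
  dsimp only
  rw [map_zero, LinearMap.zero_apply, add_zero, D.id_comp]

section

variable {D : DGCat.{w, u, u} k}

/-- The component `B → A'` of a morphism from `twist μ` to `twist ν`. -/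
def twistCorner {A B A' B' : D.Obj} (μ : (D.Hom A B).cycles 1) (ν : (D.Hom A' B').cycles 1) :
    Cplx.Map (homCplx (twist μ) (twist ν)) (D.Hom B A') where
  app n :=
    { toFun := fun φ => (homV φ B (zero_add n) (D.id B, 0)).2
      map_add' := fun _ _ => rfl
      map_smul' := fun _ _ => rfl }
  comm {i j} h φ := by
    obtain ⟨⟨p, q⟩, rfl⟩ := (twistDesc_bijective μ (twist ν) i).2 φ
    have e := Prod.ext_iff.1 (congrArg twistEval (homD_twistDesc μ (twist ν) h p q))
    rw [twistEval_twistDesc] at e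
    have e' := congrArg Prod.fst (twistEval_twistDesc μ (twist ν) (p, q))
    exact (congrArg Prod.snd e.1).trans
      (congrArg (fun m : ((twist ν).obj B).X i => (D.Hom B A').d h m.2) e'.symm)

theorem twistCorner_twistDesc {A B A' B' : D.Obj} (μ : (D.Hom A B).cycles 1)
    (ν : (D.Hom A' B').cycles 1) {n : ℤ} (p : ((twist ν).obj B).X n × ((twist ν).obj A).X n) :
    (twistCorner μ ν).app n (twistDesc μ (twist ν) p) = p.1.2 :=
  congrArg (fun q => q.1.2) (twistEval_twistDesc μ (twist ν) p)

theorem twistCorner_eq_zero_iff {A B A' B' : D.Obj} {μ : (D.Hom A B).cycles 1}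
    {ν : (D.Hom A' B').cycles 1} {n : ℤ} {φ : homDeg (twist μ) (twist ν) n} :
    (twistCorner μ ν).app n φ = 0 ↔ ∃ f₁ f₂ f₂₁, triMap μ ν f₁ f₂ f₂₁ = φ := by
  constructor
  · intro h
    obtain ⟨⟨⟨f₂, g⟩, ⟨f₂₁, f₁⟩⟩, rfl⟩ := (twistDesc_bijective μ (twist ν) n).2 φ
    rw [twistCorner_twistDesc] at h
    obtain rfl : g = 0 := h
    exact ⟨f₁, f₂, f₂₁, rfl⟩
  · rintro ⟨f₁, f₂, f₂₁, rfl⟩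
    exact twistCorner_twistDesc μ ν _

theorem triMap_injective {A B A' B' : D.Obj} {μ : (D.Hom A B).cycles 1}
    {ν : (D.Hom A' B').cycles 1} {n : ℤ} {f₁ f₁' : (D.Hom A A').X n}
    {f₂ f₂' : (D.Hom B B').X n} {f₂₁ f₂₁' : (D.Hom A B').X n}
    (h : triMap μ ν f₁ f₂ f₂₁ = triMap μ ν f₁' f₂' f₂₁') :
    f₁ = f₁' ∧ f₂ = f₂' ∧ f₂₁ = f₂₁' := by
  have := Prod.ext_iff.1 ((twistDesc_bijective μ (twist ν) n).1 h)
  exact ⟨(Prod.ext_iff.1 this.2).2, (Prod.ext_iff.1 this.1).1, (Prod.ext_iff.1 this.2).1⟩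

end

end DGModule

/-! ### The gluing bimodule -/

/-- The restriction of a bimodule to induced DG-categories. -/
def DGBimodule.induced {k : Type w} [Field k] {D₂ D₁ : DGCat.{w, v, u} k} (φ : DGBimodule D₂ D₁)
    {ι₂ ι₁ : Type u} (g₂ : ι₂ → D₂.Obj) (g₁ : ι₁ → D₁.Obj) :
    DGBimodule (D₂.induced g₂) (D₁.induced g₁) where
  obj M X := φ.obj (g₂ M) (g₁ X)
  lact h := φ.lact h
  ract h := φ.ract h
  id_lact h m := φ.id_lact h m
  ract_id h m := φ.ract_id h m
  comp_lact hab hbc h h' f g m := φ.comp_lact hab hbc h h' f g m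
  ract_comp hab hbc h h' m f g := φ.ract_comp hab hbc h h' m f g
  lact_ract hab hbc h h' f m g := φ.lact_ract hab hbc h h' f m g
  lact_leibniz ha hb hc h h₁ h₂ f m := φ.lact_leibniz ha hb hc h h₁ h₂ f m
  ract_leibniz ha hb hc h h₁ h₂ m f := φ.ract_leibniz ha hb hc h h₁ h₂ m f

namespace DGCat

open DGModule

variable {k : Type w} [Field k]

/-- The bimodule `φ(M, X) = Hom_D(X, M)[1]`. The sign in the left action makes it compatible with
the differential of the shift. -/
def shiftedHom (D : DGCat.{w, v, u} k) : DGBimodule D D where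
  obj M X := (D.Hom X M).shift 1
  lact {M N X a b c} h := a.negOnePow • D.comp (a := a) (b := b + 1) (c := c + 1) (by omega)
  ract {M X Y a b c} h := D.comp (a := a + 1) (b := b) (c := c + 1) (by omega)
  id_lact h m := by
    change (0 : ℤ).negOnePow • D.comp _ (D.id _) m = m
    rw [Int.negOnePow_zero, one_smul, D.id_comp]
  ract_id h m := D.comp_id _ m
  comp_lact {L M N X a b c ab bc abc} hab hbc h h' f e m := by
    change ab.negOnePow • D.comp _ (D.comp _ f e) m =
      a.negOnePow • D.comp _ f (b.negOnePow • D.comp _ e m)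
    rw [D.assoc (bc := bc + 1) _ (by omega) _ (by omega), Units.smul_def b.negOnePow, map_zsmul,
      ← Units.smul_def, smul_smul, ← Int.negOnePow_add, hab]
  ract_comp hab hbc h h' m f e := D.assoc _ _ _ _ m f e
  lact_ract {M N X Y a b c ab bc abc} hab hbc h h' f m e := by
    change D.comp _ (a.negOnePow • D.comp _ f m) e = a.negOnePow • D.comp _ f (D.comp _ m e)
    rw [Units.smul_def, map_zsmul, LinearMap.smul_apply,
      D.assoc (bc := bc + 1) _ (by omega) _ (by omega), ← Units.smul_def]
  lact_leibniz {M N X a a' b b' c c'} ha hb hc h h₁ h₂ f m := by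
    have ha' : a'.negOnePow = -a.negOnePow := by rw [← ha, Int.negOnePow_succ]
    change (1 : ℤ).negOnePow • (D.Hom _ _).d _ (a.negOnePow • D.comp _ f m) =
      a'.negOnePow • D.comp _ ((D.Hom _ _).d ha f) m +
        a.negOnePow • a.negOnePow • D.comp _ f ((1 : ℤ).negOnePow • (D.Hom _ _).d _ m)
    rw [Units.smul_def a.negOnePow, map_zsmul,
      D.leibniz (a' := a') (b' := b' + 1) ha (by omega) _ _ (by omega) (by omega), ha']
    simp only [Int.negOnePow_one, Units.neg_smul, one_smul, map_neg, smul_neg, smul_add,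
      ← Units.smul_def]
  ract_leibniz {M X Y a a' b b' c c'} ha hb hc h h₁ h₂ m f := by
    change (1 : ℤ).negOnePow • (D.Hom _ _).d _ (D.comp _ m f) =
      D.comp _ ((1 : ℤ).negOnePow • (D.Hom _ _).d _ m) f +
        a.negOnePow • D.comp _ m ((D.Hom _ _).d hb f)
    rw [D.leibniz (a' := a' + 1) (b' := b' ) (by omega) hb _ _ (by omega) (by omega)]
    simp only [Int.negOnePow_succ, Int.negOnePow_one, Units.neg_smul, one_smul, map_neg,
      LinearMap.neg_apply, neg_add, neg_neg]

/-- The bimodule `φ(M, X) = Hom_D(g₁ X, g₂ M)[1]`. -/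
abbrev homBimodule (D : DGCat.{w, v, u} k) {ι₁ ι₂ : Type u} (g₁ : ι₁ → D.Obj)
    (g₂ : ι₂ → D.Obj) : DGBimodule (D.induced g₂) (D.induced g₁) :=
  D.shiftedHom.induced g₂ g₁

section

variable {D : DGCat.{w, v, u} k} {ι₁ ι₂ : Type u} {g₁ : ι₁ → D.Obj} {g₂ : ι₂ → D.Obj}

/-- The closed morphism of degree `1` of `D` that is part of an object of the gluing. -/
def gluingCycle (M : (D.homBimodule g₁ g₂).GluingObj) : (D.Hom (g₁ M.fst) (g₂ M.snd)).cycles 1 :=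
  ⟨M.μ.1, (smul_eq_zero_iff_eq (Int.negOnePow 1)).1 M.μ.2⟩

end

variable {D : DGCat.{w, u, u} k} {ι₁ ι₂ : Type u} {g₁ : ι₁ → D.Obj} {g₂ : ι₂ → D.Obj}

/-! ### The zigzag of quasiequivalences -/

/-- The DG-modules over `D` represented by objects of `D` and the twisted sums defined by objects
of the gluing. The DG-category induced by this family receives quasiequivalences from both `D` and
the gluing. -/
def repOrTwist (D : DGCat.{w, u, u} k) {ι₁ ι₂ : Type u} (g₁ : ι₁ → D.Obj) (g₂ : ι₂ → D.Obj) :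
    D.Obj ⊕ (D.homBimodule g₁ g₂).GluingObj → DGModule D :=
  Sum.elim D.yonedaObj fun M => twist (gluingCycle M)

/-- The Yoneda DG-functor. -/
def yonedaFunctor (D : DGCat.{w, u, u} k) {ι₁ ι₂ : Type u} (g₁ : ι₁ → D.Obj) (g₂ : ι₂ → D.Obj) :
    DGFunctor D (D.dgm.induced (D.repOrTwist g₁ g₂)) where
  obj := Sum.inl
  map X Y :=
    { app := fun _ => yonedaDesc (X := X) (D.yonedaObj Y)
      comm := fun h f => (homD_yonedaDesc (D.yonedaObj Y) h f).symm }
  map_id X := yonedaDesc_id X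
  map_comp h f g := yonedaDesc_comp h f g

theorem yonedaFunctor_isQuasiequivalence (hD : D.IsPretriangulated) :
    (D.yonedaFunctor g₁ g₂).IsQuasiequivalence := by
  refine ⟨fun X Y => ?_, ?_⟩
  · have : ((D.yonedaFunctor g₁ g₂).map X Y).IsConeAcyclic :=
      Cplx.Map.isConeAcyclic_of_bijective fun n => yonedaDesc_bijective (X := X) (D.yonedaObj Y) n
    exact this.isQuasiIso
  · rintro (Y | M)
    · exact ⟨Y, Homotopic.refl _ _⟩
    · obtain ⟨C, hC⟩ := hD.exists_homotopic_twist (gluingCycle M)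
      exact ⟨C, induced_homotopic hC⟩

/-- The last component of the differential of the gluing, for the bimodule `shiftedHom`, agrees with
that of `homD_triMap`. -/
theorem castX_gluing_d {A B A' B' : D.Obj} (μ : (D.Hom A B).X 1) (ν : (D.Hom A' B').X 1)
    {i j i' j' : ℤ} (h : i + 1 = j) (hi : i' = i) (hj : j' = j) (f₁ : (D.Hom A A').X i)
    (f₂ : (D.Hom B B').X i) (f₂₁ : (D.Hom A B').X i') :
    (D.Hom A B').castX hj (-(Int.negOnePow 1 • (D.Hom A B').d (by omega) f₂₁) -
        i.negOnePow • D.comp (by omega) f₂ μ + D.comp (by omega) ν f₁) =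
      (D.Hom A B').d h ((D.Hom A B').castX hi f₂₁) + D.comp (by omega) ν f₁ -
        i.negOnePow • D.comp h f₂ μ := by
  subst hi hj
  rw [Int.negOnePow_one, Units.neg_smul, one_smul, neg_neg, Cplx.castX_rfl, Cplx.castX_rfl]
  abel

/-- The last component of the composition of the gluing, for the bimodule `shiftedHom`, agrees with
that of `homComp_triMap`. -/
theorem castX_gluing_comp {A B A' B'' : D.Obj} {a b c a' b' c' : ℤ} (h : a + b = c)
    (ha : a' = a) (hb : b' = b) (hc : c' = c) (e₁ : (D.Hom A A').X b) (f₂ : (D.Hom B B'').X a)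
    (f₂₁ : (D.Hom A' B'').X a') (e₂₁ : (D.Hom A B).X b') :
    (D.Hom A B'').castX hc (D.comp (by omega) f₂₁ e₁ +
        a.negOnePow • a.negOnePow • D.comp (by omega) f₂ e₂₁) =
      D.comp h ((D.Hom A' B'').castX ha f₂₁) e₁ + D.comp h f₂ ((D.Hom A B).castX hb e₂₁) := by
  subst ha hb hc
  rw [smul_smul, Int.units_mul_self, one_smul]
  rfl

/-- The DG-functor sending an object of the gluing to the twisted sum that it defines. -/
def gluingFunctor (D : DGCat.{w, u, u} k) {ι₁ ι₂ : Type u} (g₁ : ι₁ → D.Obj) (g₂ : ι₂ → D.Obj) :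
    DGFunctor (D.homBimodule g₁ g₂).gluing (D.dgm.induced (D.repOrTwist g₁ g₂)) where
  obj := Sum.inr
  map M N :=
    { app := fun n =>
        { toFun := fun f => triMap (gluingCycle M) (gluingCycle N) f.1 f.2.1
            ((D.Hom (g₁ M.fst) (g₂ N.snd)).castX (sub_add_cancel n 1) f.2.2)
          map_add' := fun f f' => by
            refine Eq.trans ?_ (triMap_add _ _ _ _ _ _ _ _)
            exact congrArg (triMap _ _ _ _) (map_add _ f.2.2 f'.2.2)
          map_smul' := fun r f => by
            refine Eq.trans ?_ (triMap_smul _ _ r _ _ _)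
            exact congrArg (triMap _ _ _ _) (map_smul _ r f.2.2) }
      comm := fun {i j} h f => by
        refine Eq.trans (congrArg (triMap _ _ _ _) ?_)
          (homD_triMap (gluingCycle M) (gluingCycle N) h _ _ _).symm
        exact castX_gluing_d (D := D) (gluingCycle M).1 (gluingCycle N).1 h (sub_add_cancel i 1)
          (sub_add_cancel j 1) f.1 f.2.1 f.2.2 }
  map_id M := by
    refine Eq.trans ?_ (triMap_id (gluingCycle M))
    exact congrArg (triMap _ _ _ _) (map_zero _)
  map_comp {L M N a b c} h f g := by
    refine Eq.trans (congrArg (triMap _ _ _ _) ?_)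
      (homComp_triMap (gluingCycle L) (gluingCycle M) (gluingCycle N) h _ _ _ _ _ _).symm
    exact castX_gluing_comp (D := D) (A := g₁ L.fst) (A' := g₁ M.fst) (B := g₂ M.snd)
      (B'' := g₂ N.snd) h (sub_add_cancel a 1) (sub_add_cancel b 1) (sub_add_cancel c 1)
      g.1 f.2.1 f.2.2 g.2.2

/-- The missing corner of the triangular matrices consists of the complexes
`Hom(g₂ j, g₁ i)`; if these are acyclic and every object of `D` is an extension of some `g₁ i` by
some `g₂ j`, the gluing is quasiequivalent to the DG-category of twisted sums. -/
theorem gluingFunctor_isQuasiequivalence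
    (hacyclic : ∀ (j : ι₂) (i : ι₁) {m n : ℤ} (h : m + 1 = n) (f : (D.Hom (g₂ j) (g₁ i)).X n),
      f ∈ (D.Hom (g₂ j) (g₁ i)).cycles n → ∃ f', (D.Hom (g₂ j) (g₁ i)).d h f' = f)
    (hext : ∀ F : D.Obj, ∃ (i : ι₁) (j : ι₂) (μ : (D.Hom (g₁ i) (g₂ j)).cycles 1),
      D.dgm.Homotopic (twist μ) (D.yonedaObj F)) :
    (D.gluingFunctor g₁ g₂).IsQuasiequivalence := by
  refine ⟨fun M N => ?_, ?_⟩
  · have : ((D.gluingFunctor g₁ g₂).map M N).IsConeAcyclic := by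
      refine Cplx.Map.isConeAcyclic_of_acyclic_cokernel
        (twistCorner (gluingCycle M) (gluingCycle N)) (fun n f f' h => ?_) (fun n f => ?_)
        (fun n f => ?_) (fun n φ h => ?_) (hacyclic M.snd N.fst)
      · obtain ⟨h₁, h₂, h₃⟩ := triMap_injective h
        exact Prod.ext h₁ (Prod.ext h₂ (Cplx.castX_injective (D.Hom (g₁ M.fst) (g₂ N.snd)) _ h₃))
      · exact ⟨twistDesc _ (twist (gluingCycle N)) ((0, f), 0), twistCorner_twistDesc _ _ _⟩
      · exact twistCorner_twistDesc _ _ _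
      · -- The complex of the gluing has `f₂₁` in degree `n - 1 + 1` instead of `n`.
        obtain ⟨f₁, f₂, f₂₁, rfl⟩ := twistCorner_eq_zero_iff.1 h
        obtain ⟨f₂₁, rfl⟩ := Cplx.castX_surjective _ (sub_add_cancel n 1) f₂₁
        exact ⟨(f₁, f₂, f₂₁), rfl⟩
    exact this.isQuasiIso
  · rintro (F | M)
    · obtain ⟨i, j, μ, h⟩ := hext F
      have hμ : μ.1 ∈ ((D.homBimodule g₁ g₂).obj j i).cycles 0 :=
        (smul_eq_zero_iff_eq (Int.negOnePow 1)).2 μ.2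
      exact ⟨⟨i, j, ⟨μ.1, hμ⟩⟩, induced_homotopic h⟩
    · exact ⟨M, Homotopic.refl _ _⟩

end DGCat

theorem mainTheorem11 {k : Type w} [Field k] (D : DGCat.{w, u, u} k) (hD : D.IsPretriangulated)
    (T₁ T₂ : ObjectProperty D.HoCat) (hT : D.IsSemiorthogonalDecomposition T₁ T₂) :
    ∃ (D₁ D₂ : DGCat.{w, u, u} k) (φ : DGBimodule D₂ D₁),
      D₁.IsPretriangulated ∧ D₂.IsPretriangulated ∧
      (∃ F₁ : DGFunctor D₁ D, F₁.InducesEquivalence T₁) ∧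
      (∃ F₂ : DGFunctor D₂ D, F₂.InducesEquivalence T₂) ∧
      Quasiequivalent D φ.gluing := by
  let g₁ : {X : D.Obj // T₁ ⟨X⟩} → D.Obj := Subtype.val
  let g₂ : {X : D.Obj // T₂ ⟨X⟩} → D.Obj := Subtype.val
  refine ⟨_, _, D.homBimodule g₁ g₂, hT.triangulated₁.isPretriangulated hD,
    hT.triangulated₂.isPretriangulated hD, ⟨_, D.inducedFunctor_inducesEquivalence T₁⟩,
    ⟨_, D.inducedFunctor_inducesEquivalence T₂⟩,
    .trans _ _ _ (.rel _ _ ⟨_, DGCat.yonedaFunctor_isQuasiequivalence hD⟩)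
      (.symm _ _ (.rel _ _ ⟨_, DGCat.gluingFunctor_isQuasiequivalence ?_ ?_⟩))⟩
  · exact fun j i m n h f hf => hT.exists_d_eq hD j.2 i.2 h f hf
  · intro F
    obtain ⟨F₂, F₁, f, h₂, h₁, hf⟩ := hT.exists_triangle F
    obtain ⟨μ, hμ⟩ := hf.exists_twist_homotopic
    exact ⟨⟨F₁, h₁⟩, ⟨F₂, h₂⟩, μ, hμ⟩
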